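/- Fix integers $k\ge 1$ and $m>1$. For $1\le i\le k$ let $R_i=(i^{k+1-i})$ be the rectangular partition with $k+1-i$ parts equal to $i$; for partitions $\lambda,\mu$ let $\lambda\cup\mu$ be the partition whose multiset of parts is the union (with multiplicities added) of those of $\lambda$ and $\mu$. Let $Y^k_m$ be the set of ($k$-bounded) partitions $\lambda$ whose Young diagram is contained in that of $R_{i_1}\cup\dots\cup R_{i_{m-1}}$ for some $i_1,\dots,i_{m-1}\in\{1,\dots,k\}$. *Cores.* For a $(k+1)$-core $\mu$ (a partition with no hook length equal to $k+1$) let $\mathfrak p(\mu)$ be the $k$-bounded partition whose $r$-th part is the number of cells in row $r$ of $\mu$ with hook length less than $k+1$; $\mathfrak p$ is a bijection from $(k+1)$-cores to $k$-bounded partitions, with inverse $\mathfrak c$. For $i\in\mathbb Z/(k+1)$ let $s_i$ act on $(k+1)$-cores by adding all addable cells of content $i$ modulo $k+1$ if there is one, and otherwise by removing all removable cells of content $i$ modulo $k+1$. The $k$-Young lattice on $k$-bounded partitions has the covering relation $\lambda\lessdot\mu$ if $|\mu|=|\lambda|+1$ and $s_i\mathfrak c(\lambda)=\mathfrak c(\mu)$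 for some $i$. *Alcoves.* Let $V$ be the real vector space with basis the simple roots $\alpha_1,\dots,\alpha_k$ of type $A_k$, with the bilinear form given by the Cartan matrix, let $\Lambda_1,\dots,\Lambda_k$ be the dual basis, $\phi=\alpha_1+\dots+\alpha_k$, $C=\{x:\langle\alpha_i,x\rangle\ge 0 \text{ for all } i\}$ and $A_\emptyset=\{x\in C:\langle\phi,x\rangle\le 1\}$. The affine Weyl group $W$ is generated by the reflections $s_i$ in $\langle\alpha_i,x\rangle=0$ ($1\le i\le k$) and $s_0$ in $\langle\phi,x\rangle=1$; the alcoves are the sets $A_w=w^{-1}A_\emptyset$, $w\in W$. A $k$-bounded partition $\lambda$ corresponds to an alcove $A\subseteq C$ if $A=A_w$ and $w\emptyset=\mathfrak c(\lambda)$ for some $w\in W$, where $w=s_{i_1}\cdots s_{i_r}$ acts on cores by $s_{i_1}\cdots s_{i_r}$. **Theorem.** This correspondence restricts to a bijection between $Y^k_m$ and the set of alcoves $A\subseteq C$ with $\langle\phi,x\rangle\le m$ for all $x\in A$, i.e. the alcoves contained in the $m$-fold dilation $mA_\emptyset$: each element of either set corresponds to exactly one alcove, respectively partition, and this one lies in the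 other set. There are an affine automorphism $\rho$ of $V$ that rotates the vertices of $mA_\emptyset$, $$0\mapsto m\Lambda_1\mapsto m\Lambda_2\mapsto\dots\mapsto m\Lambda_k\mapsto 0,$$ and a permutation $\sigma$ of $Y^k_m$ such that, if $\lambda\in Y^k_m$ corresponds to $A$, then $\sigma(\lambda)$ corresponds to $\rho(A)$. The permutation $\sigma$ has order exactly $k+1$, so it defines a faithful action of the cyclic group of order $k+1$ on $Y^k_m$, and it is an automorphism of the Hasse diagram of $Y^k_m$ in the $k$-Young lattice, as an undirected graph. For $m=2$ it is Suter's symmetry of $Y^k_2=\{\lambda:\lambda\subseteq R_i\text{ for some }i\}$: $\sigma(\lambda)$ is obtained from $\lambda$ by deleting the first part $\lambda_1$ (with $\lambda_1=0$ if $\lambda=\emptyset$) and putting a column of $k-\lambda_1$ cells to the left of the remaining diagram. -/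

import Mathlib

namespace KBounded

/-! ### Partitions, hooks and cores

A partition is a `YoungDiagram`; the cell in row `r` and column `c` (both counted from `0`) is
`(r, c)`, and `lam.rowLen r` is the part of index `r`. -/

/-- The partition whose multiset of (non-zero) parts is `s`. -/
def ofParts (s : Multiset ℕ) : YoungDiagram :=
  YoungDiagram.ofRowLens (s.sort (· ≥ ·))
    (List.sortedGE_iff_pairwise.mpr (Multiset.pairwise_sort s (· ≥ ·)))

/-- The parts of the `k`-rectangle `R_i = (i^{k+1-i})`. -/
def rectParts (k i : ℕ) : Multiset ℕ := Multiset.replicate (k + 1 - i) i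

/-- `lam` is `k`-bounded: all its parts are at most `k`. -/
def IsKBounded (k : ℕ) (lam : YoungDiagram) : Prop := ∀ r, lam.rowLen r ≤ k

/-- The set `Y^k_m` of `k`-bounded partitions contained in some `R_{i_1} ∪ ⋯ ∪ R_{i_{m-1}}` with
`1 ≤ i_j ≤ k`; the union of partitions is the partition whose multiset of parts is the sum of
their multisets of parts. -/
def Y (k m : ℕ) : Set YoungDiagram :=
  {lam | IsKBounded k lam ∧ ∃ i : Fin (m - 1) → ℕ, (∀ j, 1 ≤ i j ∧ i j ≤ k) ∧
    lam ≤ ofParts (∑ j, rectParts k (i j))}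

/-- The hook length of a cell of `mu`. -/
def hook (mu : YoungDiagram) (r c : ℕ) : ℕ := (mu.rowLen r - c) + (mu.colLen c - r) - 1

/-- `mu` is a `(k+1)`-core: no cell has hook length `k+1`. -/
def IsCore (k : ℕ) (mu : YoungDiagram) : Prop := ∀ r c, (r, c) ∈ mu → hook mu r c ≠ k + 1

/-- `mu` is a `(k+1)`-core and `lam` is the `k`-bounded partition corresponding to it: the part of
`lam` of index `r` is the number of cells in row `r` of `mu` with hook length less than `k+1`.
That is, `lam = 𝔭(mu)` and `mu = 𝔠(lam)`. -/
def IsCoreOf (k : ℕ) (mu lam : YoungDiagram) : Prop :=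
  IsCore k mu ∧
    ∀ r, lam.rowLen r = ((Finset.range (mu.rowLen r)).filter fun c => hook mu r c < k + 1).card

/-- The cell `x` can be added to `mu`. -/
def IsAddable (mu : YoungDiagram) (x : ℕ × ℕ) : Prop :=
  x ∉ mu ∧ IsLowerSet (insert x (mu.cells : Set (ℕ × ℕ)))

/-- The cell `x` can be removed from `mu`. -/
def IsRemovable (mu : YoungDiagram) (x : ℕ × ℕ) : Prop :=
  x ∈ mu ∧ IsLowerSet ((mu.cells : Set (ℕ × ℕ)) \ {x})

/-- The content of the cell `x` is `i` modulo `k+1`. -/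
def HasContent {k : ℕ} (i : Fin (k + 1)) (x : ℕ × ℕ) : Prop :=
  (x.2 : ℤ) - (x.1 : ℤ) ≡ ((i : ℕ) : ℤ) [ZMOD ((k + 1 : ℕ) : ℤ)]

lemma IsAddable.le {mu : YoungDiagram} {x : ℕ × ℕ} (h : IsAddable mu x) :
    x.1 < mu.colLen 0 + 1 ∧ x.2 < mu.rowLen 0 + 1 := by
  obtain ⟨a, b⟩ := x
  obtain ⟨-, h2⟩ := h
  constructor
  · rcases a with _ | a
    · simp
    · have := h2 (a := (a + 1, b)) (b := (a, 0)) (by simp [Prod.le_def]) (by simp)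
      simp only [Set.mem_insert_iff, Prod.mk.injEq, Finset.mem_coe, YoungDiagram.mem_cells] at this
      rcases this with h | h
      · omega
      · have := YoungDiagram.mem_iff_lt_colLen.mp h
        simp only; omega
  · rcases b with _ | b
    · simp
    · have := h2 (a := (a, b + 1)) (b := (0, b)) (by simp [Prod.le_def]) (by simp)
      simp only [Set.mem_insert_iff, Prod.mk.injEq, Finset.mem_coe, YoungDiagram.mem_cells] at this
      rcases this with h | h
      · omega
      · have := YoungDiagram.mem_iff_lt_rowLen.mp h
        simp only; omega

open Classical in
/-- `mu` together with all its addable cells of content `i`. -/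
noncomputable def addCells {k : ℕ} (i : Fin (k + 1)) (mu : YoungDiagram) : YoungDiagram where
  cells := mu.cells ∪
    ((Finset.range (mu.colLen 0 + 1) ×ˢ Finset.range (mu.rowLen 0 + 1)).filter
      fun x => IsAddable mu x ∧ HasContent i x)
  isLowerSet := by
    intro a b hba ha
    simp only [Finset.coe_union, Set.mem_union, Finset.mem_coe, Finset.mem_filter] at ha ⊢
    rcases ha with ha | ⟨h1, h2, h3⟩
    · exact Or.inl (mu.isLowerSet hba ha)
    · have := h2.2 hba (Set.mem_insert _ _)
      rcases this with rfl | h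
      · exact Or.inr ⟨h1, h2, h3⟩
      · exact Or.inl h

open Classical in
/-- `mu` without its removable cells of content `i`. -/
noncomputable def removeCells {k : ℕ} (i : Fin (k + 1)) (mu : YoungDiagram) : YoungDiagram where
  cells := mu.cells.filter fun x => ¬ (IsRemovable mu x ∧ HasContent i x)
  isLowerSet := by
    intro a b hba ha
    simp only [Finset.coe_filter, Set.mem_ofPred_eq] at ha ⊢
    refine ⟨mu.isLowerSet hba ha.1, fun h => ?_⟩
    by_cases hab : a = b
    · subst hab; exact ha.2 h
    · have := h.1.2 hba ⟨ha.1, hab⟩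
      exact this.2 rfl

lemma mem_addCells {k : ℕ} (i : Fin (k + 1)) (mu : YoungDiagram) (x : ℕ × ℕ) :
    x ∈ addCells i mu ↔ x ∈ mu ∨ (IsAddable mu x ∧ HasContent i x) := by
  rw [← YoungDiagram.mem_cells, ← YoungDiagram.mem_cells]
  simp only [addCells, Finset.mem_union, Finset.mem_filter, Finset.mem_product, Finset.mem_range]
  exact ⟨fun h => h.imp id And.right, fun h => h.imp id fun h => ⟨h.1.le, h⟩⟩

lemma mem_removeCells {k : ℕ} (i : Fin (k + 1)) (mu : YoungDiagram) (x : ℕ × ℕ) :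
    x ∈ removeCells i mu ↔ x ∈ mu ∧ ¬ (IsRemovable mu x ∧ HasContent i x) := by
  rw [← YoungDiagram.mem_cells, ← YoungDiagram.mem_cells]
  simp only [removeCells, Finset.mem_filter]

open Classical in
/-- The action of the generator `s_i` on `(k+1)`-cores: add all addable cells of content `i` if
there is one, otherwise remove all removable cells of content `i` (possibly none). -/
noncomputable def coreAct {k : ℕ} (i : Fin (k + 1)) (mu : YoungDiagram) : YoungDiagram :=
  if ∃ x, IsAddable mu x ∧ HasContent i x then addCells i mu else removeCells i mu

/-- `s_{i_1} ⋯ s_{i_r} ∅` for the word `l = [i_1, …, i_r]`. -/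
noncomputable def wordCore {k : ℕ} (l : List (Fin (k + 1))) : YoungDiagram :=
  l.foldr coreAct ⊥

/-- The covering relation `lam ⋖ mu` of the `k`-Young lattice. -/
def KCovers (k : ℕ) (lam mu : YoungDiagram) : Prop :=
  lam.card + 1 = mu.card ∧ ∃ κ ν : YoungDiagram, IsCoreOf k κ lam ∧ IsCoreOf k ν mu ∧
    ∃ i : Fin (k + 1), coreAct i κ = ν

/-- The (undirected) edges of the Hasse diagram of the `k`-Young lattice. -/
def HasseAdj (k : ℕ) (lam mu : YoungDiagram) : Prop := KCovers k lam mu ∨ KCovers k mu lam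

/-! ### The affine Weyl group of type `A_k` and its alcoves

`V k` is the real vector space with basis the simple roots; the simple root
`α_i`, `1 ≤ i ≤ k`, has index `i - 1 : Fin k`. -/

/-- The space spanned by the simple roots, in coordinates with respect to them. -/
abbrev V (k : ℕ) : Type := Fin k → ℝ

/-- The symmetric bilinear form on `V k` whose Gram matrix is the Cartan matrix of type `A_k`. -/
noncomputable def form (k : ℕ) : LinearMap.BilinForm ℝ (V k) :=
  Matrix.toBilin' ((CartanMatrix.A k).map (fun z : ℤ => (z : ℝ)))

/-- The simple roots. -/
def simpleRoot {k : ℕ} (i : Fin k) : V k := Pi.single i 1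

/-- The highest root `φ = α_1 + ⋯ + α_k`. -/
def highestRoot (k : ℕ) : V k := ∑ i, simpleRoot i

/-- The fundamental weights, the basis dual to the simple roots
(see `form_simpleRoot_fundamentalWeight`). -/
noncomputable def fundamentalWeight {k : ℕ} (i : Fin k) : V k := fun j =>
  min ((i : ℝ) + 1) ((j : ℝ) + 1) - ((i : ℝ) + 1) * ((j : ℝ) + 1) / ((k : ℝ) + 1)

/-- The orthogonal reflection of `V k` in the affine hyperplane `⟨α, x⟩ = p`. -/
noncomputable def reflection {k : ℕ} (α : V k) (p : ℝ) : Equiv.Perm (V k) :=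
  Function.Involutive.toPerm
    (fun x => x - (2 * (form k α x - p) / form k α α) • α) (by
      intro x
      simp only [map_sub, map_smul, smul_eq_mul]
      by_cases h : form k α α = 0
      · simp [h]
      · rw [sub_sub, ← add_smul]
        have : 2 * (form k α x - p) / form k α α +
          2 * (form k α x - 2 * (form k α x - p) / form k α α * form k α α - p) / form k α α
            = 0 := by
          field_simp
          ring
        rw [this]; simp)

/-- The generators of the affine Weyl group: `s_0` is the reflection in `H_{φ,1}` and, for
`1 ≤ i ≤ k`, `s_i` is the reflection in `H_{α_i,0}`. -/
noncomputable def gen {k : ℕ} : Fin (k + 1) → Equiv.Perm (V k) :=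
  Fin.cases (reflection (highestRoot k) 1) (fun i => reflection (simpleRoot i) 0)

/-- The affine Weyl group of type `A_k`, acting on `V k`. -/
noncomputable def affineWeyl (k : ℕ) : Subgroup (Equiv.Perm (V k)) :=
  Subgroup.closure (Set.range gen)

/-- The (closed) dominant chamber. -/
def dominantChamber (k : ℕ) : Set (V k) := {x | ∀ i, 0 ≤ form k (simpleRoot i) x}

/-- The (closed) fundamental alcove. -/
def fundamentalAlcove (k : ℕ) : Set (V k) := {x ∈ dominantChamber k | form k (highestRoot k) x ≤ 1}

/-- The alcove `A_w = w⁻¹ A_∅`. -/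
def alcove {k : ℕ} (w : Equiv.Perm (V k)) : Set (V k) := (⇑w⁻¹) '' fundamentalAlcove k

/-- The set of alcoves in the dominant chamber that are bounded by `H_{φ,m}`, that is, the alcoves
contained in the `m`-fold dilation of the fundamental alcove. -/
def dominantAlcoves (k m : ℕ) : Set (Set (V k)) :=
  {A | (∃ w ∈ affineWeyl k, A = alcove w) ∧ A ⊆ dominantChamber k ∧
    ∀ x ∈ A, form k (highestRoot k) x ≤ m}

/-- The partition `lam` corresponds to the dominant alcove `A`: for some
`w = s_{i_1} ⋯ s_{i_r}` one has `A = A_w` and `w ∅ = 𝔠(lam)`. -/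
def Corresponds (k : ℕ) (lam : YoungDiagram) (A : Set (V k)) : Prop :=
  A ⊆ dominantChamber k ∧
    ∃ l : List (Fin (k + 1)), A = alcove (l.map gen).prod ∧ IsCoreOf k (wordCore l) lam

/-- The vertices `0, mΛ_1, …, mΛ_k` of the `m`-fold dilation of the fundamental alcove. -/
noncomputable def dilatedVertex (k m : ℕ) : Fin (k + 1) → V k :=
  Fin.cases 0 (fun i => (m : ℝ) • fundamentalWeight i)

lemma form_simpleRoot (k : ℕ) (i : Fin k) (x : V k) :
    form k (simpleRoot i) x = ∑ j, (CartanMatrix.A k i j : ℝ) * x j := by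
  simp [form, simpleRoot, Matrix.toBilin'_apply', Matrix.mulVec, dotProduct, Pi.single_apply]

lemma sum_cartan (k : ℕ) (i : Fin k) (f : ℝ → ℝ) (h0 : f (-1) = 0) (hk : f k = 0) :
    ∑ j : Fin k, (CartanMatrix.A k i j : ℝ) * f j = 2 * f i - f (i + 1) - f (i - 1) := by
  have e : ∀ j : Fin k, (CartanMatrix.A k i j : ℝ) * f j =
      (if i = j then 2 * f j else 0) - (if (i : ℕ) + 1 = j then f j else 0)
        - (if (j : ℕ) + 1 = i then f j else 0) := by
    intro j
    simp only [CartanMatrix.A, Matrix.of_apply, Fin.ext_iff]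
    split_ifs <;> first | omega | (push_cast; ring)
  rw [Finset.sum_congr rfl fun j _ => e j, Finset.sum_sub_distrib, Finset.sum_sub_distrib,
    Finset.sum_ite_eq]
  have e1 : ∑ j : Fin k, (if (i : ℕ) + 1 = j then f j else 0) = f (i + 1) := by
    by_cases h : (i : ℕ) + 1 < k
    · rw [Finset.sum_eq_single (⟨(i : ℕ) + 1, h⟩ : Fin k)]
      · simp
      · intro b _ hb
        rw [if_neg]
        intro h'
        exact hb (Fin.ext h'.symm)
      · simp
    · have : ((i : ℕ) : ℝ) + 1 = k := by
        have : (i : ℕ) + 1 = k := by omega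
        exact_mod_cast this
      rw [this, hk]
      refine Finset.sum_eq_zero fun j _ => if_neg (by omega)
  have e2 : ∑ j : Fin k, (if (j : ℕ) + 1 = i then f j else 0) = f (i - 1) := by
    by_cases h : (i : ℕ) = 0
    · rw [h]
      simp [h0]
    · obtain ⟨a, ha⟩ := Nat.exists_eq_succ_of_ne_zero h
      rw [Finset.sum_eq_single (⟨a, by omega⟩ : Fin k)]
      · simp [ha]
      · intro b _ hb
        rw [if_neg]
        intro h'
        exact hb (Fin.ext (by simp only; omega))
      · simp
  rw [e1, e2]
  simp

lemma form_simpleRoot_fundamentalWeight (k : ℕ) (i j : Fin k) :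
    form k (simpleRoot i) (fundamentalWeight j) = if i = j then 1 else 0 := by
  have hk : (k : ℝ) + 1 ≠ 0 := by positivity
  have hj : (j : ℝ) + 1 ≤ k := by exact_mod_cast j.isLt
  have hj0 : (0 : ℝ) ≤ j := Nat.cast_nonneg _
  rw [form_simpleRoot]
  have := sum_cartan k i
    (fun t => min ((j : ℝ) + 1) (t + 1) - ((j : ℝ) + 1) * (t + 1) / ((k : ℝ) + 1))
    (by simp; linarith) (by
      rw [min_eq_left (by linarith)]
      field_simp
      ring)
  unfold fundamentalWeight
  rw [this]
  rcases lt_trichotomy (i : ℕ) j with h | h | h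
  · have h' : (i : ℝ) + 1 ≤ j := by exact_mod_cast h
    rw [if_neg (by intro e; rw [e] at h; omega), min_eq_right (by linarith),
      min_eq_right (by linarith), min_eq_right (by linarith)]
    ring
  · have h' : (i : ℝ) = j := by exact_mod_cast h
    rw [if_pos (Fin.ext h), h', min_eq_right (by linarith),
      min_eq_left (by linarith), min_eq_right (by linarith)]
    ring
  · have h' : (j : ℝ) + 1 ≤ i := by exact_mod_cast h
    rw [if_neg (by intro e; rw [e] at h; omega), min_eq_left (by linarith),
      min_eq_left (by linarith), min_eq_left (by linarith)]
    ring

end KBounded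

/-! Partitions and dominant alcoves are both encoded by the same datum, a window: the values `g 0 <
... < g k` on `0, ..., k` of an affine permutation `w` of ℤ. The generator `s_i` acts on ℤ as
`affSwap k i`. On cores it applies this transposition to the beads (`beadSet_coreAct`), so the beads
of `w∅` are the images of the negative integers, and `g i` is the first vacant position of its
residue class (`beadSet_wordCore_eq`). On `V k`, realised as sum-zero vectors extended
quasi-periodically to ℤ, `s_i` precomposes with the transposition (`affCoord_gen`). Hence the alcove
of `w` consists of the points whose extended coordinates are ordered oppositely to the values of `w`
(`alcove_word`), and dominance of the alcove means that `g` increases.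

The rest is read off from the window. The bound ⟨φ,x⟩ ≤ m on the alcove says g k - g 0 < (k+1)m.
Column c of the bounded partition has Σ_i max(0, ⌊(g i - g c)/(k+1)⌋) cells (`IsShape.colLen_eq`),
while column c of a union of rectangles has Σ_a #{t : c < i_t ≤ a} cells. Comparing the two sums
turns membership in `Y k m` into the same inequality (`IsShape.mem_Y_iff`).

The rotation shifts the coordinates cyclically, up to a translation, and acts on windows by
`rotateWindow`, which has order k+1 and turns `affSwap k c` into `affSwap k (c + m)`. Edges of the
Hasse diagram are the pairs of windows related by some `affSwap`, because such a step between
windows always changes the size by exactly one (`card_affSwap`). The rotation therefore preserves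
edges. For m = 2 all the floors are at most 1, and the column formula becomes Suter's rule. -/

namespace KBounded

/-! ### Affine permutations and windows -/

/-- The affine transposition of `ℤ` exchanging `a - 1` and `a` for all `a ≡ c` modulo `k + 1`. -/
def affSwap (k : ℕ) (c a : ℤ) : ℤ :=
  if (k + 1 : ℤ) ∣ a + 1 - c then a + 1 else if (k + 1 : ℤ) ∣ a - c then a - 1 else a

section

variable {k : ℕ}

lemma eq_zero_of_dvd_of_lt {a : ℤ} (h : (k + 1 : ℤ) ∣ a) (h1 : -(k + 1 : ℤ) < a)
    (h2 : a < k + 1) : a = 0 :=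
  Int.eq_zero_of_abs_lt_dvd h (abs_lt.mpr ⟨h1, h2⟩)

lemma affSwap_of_dvd_succ {c a : ℤ} (h : (k + 1 : ℤ) ∣ a + 1 - c) : affSwap k c a = a + 1 :=
  if_pos h

lemma not_dvd_both [NeZero k] {c a : ℤ} (h : (k + 1 : ℤ) ∣ a + 1 - c)
    (h' : (k + 1 : ℤ) ∣ a - c) : False := by
  have hk : 0 < k := Nat.pos_of_ne_zero (NeZero.ne k)
  have h1 : (k + 1 : ℤ) ∣ 1 := by
    have := dvd_sub h h'
    rwa [show a + 1 - c - (a - c) = 1 by ring] at this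
  have := Int.le_of_dvd one_pos h1
  omega

lemma affSwap_of_dvd [NeZero k] {c a : ℤ} (h : (k + 1 : ℤ) ∣ a - c) : affSwap k c a = a - 1 := by
  unfold affSwap
  rw [if_neg fun h' => not_dvd_both h' h, if_pos h]

lemma affSwap_of_not {c a : ℤ} (h : ¬ (k + 1 : ℤ) ∣ a + 1 - c) (h' : ¬ (k + 1 : ℤ) ∣ a - c) :
    affSwap k c a = a := by
  unfold affSwap
  rw [if_neg h, if_neg h']

lemma affSwap_cases [NeZero k] (c a : ℤ) :
    ((k + 1 : ℤ) ∣ a + 1 - c ∧ ¬ (k + 1 : ℤ) ∣ a - c ∧ affSwap k c a = a + 1) ∨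
    ((k + 1 : ℤ) ∣ a - c ∧ ¬ (k + 1 : ℤ) ∣ a + 1 - c ∧ affSwap k c a = a - 1) ∨
    (¬ (k + 1 : ℤ) ∣ a + 1 - c ∧ ¬ (k + 1 : ℤ) ∣ a - c ∧ affSwap k c a = a) := by
  by_cases h : (k + 1 : ℤ) ∣ a + 1 - c
  · exact Or.inl ⟨h, fun h' => not_dvd_both h h', affSwap_of_dvd_succ h⟩
  · by_cases h' : (k + 1 : ℤ) ∣ a - c
    · exact Or.inr (Or.inl ⟨h', h, affSwap_of_dvd h'⟩)
    · exact Or.inr (Or.inr ⟨h, h', affSwap_of_not h h'⟩)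

lemma affSwap_involutive [NeZero k] (c : ℤ) : Function.Involutive (affSwap k c) := by
  intro a
  rcases affSwap_cases (k := k) c a with ⟨h, -, e⟩ | ⟨h, -, e⟩ | ⟨-, -, e⟩
  · rw [e, affSwap_of_dvd h]; ring
  · rw [e, affSwap_of_dvd_succ (by rwa [sub_add_cancel])]; ring
  · rw [e, e]

lemma affSwap_add_mul (c a t : ℤ) :
    affSwap k c (a + (k + 1) * t) = affSwap k c a + (k + 1) * t := by
  have h1 : (k + 1 : ℤ) ∣ a + (k + 1) * t + 1 - c ↔ (k + 1 : ℤ) ∣ a + 1 - c := by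
    rw [show a + (k + 1) * t + 1 - c = a + 1 - c + (k + 1) * t by ring]
    exact dvd_add_left (dvd_mul_right _ _)
  have h2 : (k + 1 : ℤ) ∣ a + (k + 1) * t - c ↔ (k + 1 : ℤ) ∣ a - c := by
    rw [show a + (k + 1) * t - c = a - c + (k + 1) * t by ring]
    exact dvd_add_left (dvd_mul_right _ _)
  unfold affSwap
  simp only [h1, h2]
  split_ifs <;> ring

lemma affSwap_congr {c d : ℤ} (h : (k + 1 : ℤ) ∣ c - d) : affSwap k c = affSwap k d := by
  funext a
  have h1 : (k + 1 : ℤ) ∣ a + 1 - c ↔ (k + 1 : ℤ) ∣ a + 1 - d := by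
    rw [show a + 1 - d = a + 1 - c + (c - d) by ring]
    exact (dvd_add_left h).symm
  have h2 : (k + 1 : ℤ) ∣ a - c ↔ (k + 1 : ℤ) ∣ a - d := by
    rw [show a - d = a - c + (c - d) by ring]
    exact (dvd_add_left h).symm
  unfold affSwap
  simp only [h1, h2]

lemma affSwap_add (c a t : ℤ) : affSwap k (c + t) (a + t) = affSwap k c a + t := by
  unfold affSwap
  rw [show a + t + 1 - (c + t) = a + 1 - c by ring, show a + t - (c + t) = a - c by ring]
  split_ifs <;> ring

lemma exists_fin_affSwap (c : ℤ) :
    ∃ i : Fin (k + 1), affSwap k c = affSwap k ((i : ℕ) : ℤ) := by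
  have h0 : 0 ≤ c % (k + 1 : ℤ) := Int.emod_nonneg _ (by omega)
  have h1 : c % (k + 1 : ℤ) < k + 1 := Int.emod_lt_of_pos _ (by omega)
  refine ⟨⟨(c % (k + 1 : ℤ)).toNat, by omega⟩, affSwap_congr ?_⟩
  simp only [Int.toNat_of_nonneg h0]
  exact Int.dvd_self_sub_emod

/-- If `affSwap` does not preserve the order of `a < b`, then it exchanges them. -/
lemma affSwap_lt_or [NeZero k] (c : ℤ) {a b : ℤ} (h : a < b) :
    affSwap k c a < affSwap k c b ∨ (b = a + 1 ∧ (k + 1 : ℤ) ∣ b - c) := by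
  by_contra! hcon
  obtain ⟨h1, h2⟩ := hcon
  rcases affSwap_cases (k := k) c a with ⟨ha, ha', e⟩ | ⟨ha, ha', e⟩ | ⟨ha, ha', e⟩ <;>
  rcases affSwap_cases (k := k) c b with ⟨hb, hb', e'⟩ | ⟨hb, hb', e'⟩ | ⟨hb, hb', e'⟩ <;>
  rw [e, e'] at h1 <;> try omega
  · have : b ≠ a + 1 := fun hh => h2 hh hb
    have : b = a + 2 := by omega
    subst this
    exact not_dvd_both (a := a + 1) (by rwa [show a + 1 + 1 - c = a + 2 - c by ring]) ha
  · have : b = a + 1 := by omega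
    subst this
    exact hb' ha

/-- The entries of `g` are pairwise incongruent modulo `k + 1`. -/
def IsResidueSystem (g : Fin (k + 1) → ℤ) : Prop := ∀ i j, (k + 1 : ℤ) ∣ g i - g j → i = j

/-- The windows of the affine permutations of minimal length in their coset. -/
structure IsWindow (g : Fin (k + 1) → ℤ) : Prop where
  strictMono : StrictMono g
  residue : IsResidueSystem g
  sum : ∑ i, g i = ∑ i : Fin (k + 1), ((i : ℕ) : ℤ)

/-- An injection of k+1 indices into `ZMod (k + 1)` is onto, so every class is represented. -/
lemma IsResidueSystem.exists_dvd {g : Fin (k + 1) → ℤ} (hg : IsResidueSystem g) (v : ℤ) :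
    ∃ i, (k + 1 : ℤ) ∣ g i - v := by
  have hinj : Function.Injective (fun i => ((g i : ℤ) : ZMod (k + 1))) := by
    intro i j h
    apply hg
    have := (ZMod.intCast_eq_intCast_iff_dvd_sub _ _ _).mp h.symm
    exact_mod_cast this
  have hb := (Fintype.bijective_iff_injective_and_card _).mpr
    ⟨hinj, by simp [ZMod.card]⟩
  obtain ⟨i, hi⟩ := hb.2 (v : ZMod (k + 1))
  refine ⟨i, ?_⟩
  have := (ZMod.intCast_eq_intCast_iff_dvd_sub _ _ _).mp hi.symm
  exact_mod_cast this

lemma isResidueSystem_id : IsResidueSystem (fun i : Fin (k + 1) => ((i : ℕ) : ℤ)) := by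
  intro i j h
  have := eq_zero_of_dvd_of_lt h (by dsimp only; omega) (by dsimp only; omega)
  dsimp only at this
  exact Fin.ext (by omega)

lemma isWindow_id : IsWindow (fun i : Fin (k + 1) => ((i : ℕ) : ℤ)) where
  strictMono := fun i j h => by simpa using h
  residue := isResidueSystem_id
  sum := rfl

lemma IsResidueSystem.map_affSwap [NeZero k] {g : Fin (k + 1) → ℤ} (hg : IsResidueSystem g) (c : ℤ) :
    IsResidueSystem (fun i => affSwap k c (g i)) := by
  intro i j ⟨t, ht⟩
  apply hg
  have : affSwap k c (g i) = affSwap k c (g j + (k + 1) * t) := by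
    rw [affSwap_add_mul]; linarith
  have := (affSwap_involutive c).injective this
  exact ⟨t, by linarith⟩

/-- Exactly one entry lies in the class of `c - 1` and moves up by one; exactly one lies in the
class of `c` and moves down by one. -/
lemma IsResidueSystem.sum_affSwap [NeZero k] {g : Fin (k + 1) → ℤ} (hg : IsResidueSystem g)
    (c : ℤ) : ∑ i, affSwap k c (g i) = ∑ i, g i := by
  obtain ⟨a, ha⟩ := hg.exists_dvd (c - 1)
  obtain ⟨b, hb⟩ := hg.exists_dvd c
  have e : ∀ i, affSwap k c (g i) = g i + (if i = a then 1 else 0)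
      - (if i = b then 1 else 0) := by
    intro i
    have h1 : (k + 1 : ℤ) ∣ g i + 1 - c ↔ i = a := by
      constructor
      · intro h
        apply hg
        rw [show g i - g a = (g i + 1 - c) - (g a - (c - 1)) by ring]
        exact dvd_sub h ha
      · rintro rfl
        rwa [show g i + 1 - c = g i - (c - 1) by ring]
    have h2 : (k + 1 : ℤ) ∣ g i - c ↔ i = b := by
      constructor
      · intro h
        apply hg
        rw [show g i - g b = (g i - c) - (g b - c) by ring]
        exact dvd_sub h hb
      · rintro rfl
        exact hb
    rcases affSwap_cases (k := k) c (g i) with ⟨h, h', e⟩ | ⟨h, h', e⟩ | ⟨h, h', e⟩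
    · rw [e, if_pos (h1.mp h), if_neg (mt h2.mpr h')]; ring
    · rw [e, if_pos (h2.mp h), if_neg (mt h1.mpr h')]; ring
    · rw [e, if_neg (mt h1.mpr h), if_neg (mt h2.mpr h')]; ring
  rw [Finset.sum_congr rfl fun i _ => e i, Finset.sum_sub_distrib, Finset.sum_add_distrib]
  simp

lemma IsWindow.map_affSwap [NeZero k] {g : Fin (k + 1) → ℤ} (hg : IsWindow g) {c : ℤ}
    (h : ∀ i j, g j = g i + 1 → ¬ (k + 1 : ℤ) ∣ g j - c) :
    IsWindow (fun i => affSwap k c (g i)) where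
  strictMono := fun i j hij => by
    rcases affSwap_lt_or (k := k) c (hg.strictMono hij) with h' | h'
    · exact h'
    · exact absurd h'.2 (h i j h'.1)
  residue := hg.residue.map_affSwap c
  sum := (hg.residue.sum_affSwap c).trans hg.sum

/-- If `affSwap` does not map a window to a window, then it exchanges two of its entries. -/
lemma IsWindow.map_affSwap_or [NeZero k] {g : Fin (k + 1) → ℤ} (hg : IsWindow g) (c : ℤ) :
    IsWindow (fun i => affSwap k c (g i)) ∨
      Set.range (fun i => affSwap k c (g i)) = Set.range g := by
  by_cases h : ∀ i j, g j = g i + 1 → ¬ (k + 1 : ℤ) ∣ g j - c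
  · exact Or.inl (hg.map_affSwap h)
  · right
    push Not at h
    obtain ⟨i, j, hij, hc⟩ := h
    have hi : affSwap k c (g i) = g j := by
      rw [hij]; exact affSwap_of_dvd_succ (by rwa [← hij])
    have hj : affSwap k c (g j) = g i := by
      rw [affSwap_of_dvd hc, hij]; ring
    have hsub : Set.range (fun i => affSwap k c (g i)) ⊆ Set.range g := by
      rintro _ ⟨a, rfl⟩
      rcases affSwap_cases (k := k) c (g a) with ⟨h, h', e⟩ | ⟨h, h', e⟩ | ⟨h, h', e⟩
      · have : a = i := by
          apply hg.residue
          rw [show g a - g i = (g a + 1 - c) - (g i + 1 - c) by ring]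
          exact dvd_sub h (by rwa [← hij])
        subst this
        exact ⟨j, hi.symm⟩
      · have : a = j := by
          apply hg.residue
          rw [show g a - g j = (g a - c) - (g j - c) by ring]
          exact dvd_sub h hc
        subst this
        exact ⟨i, hj.symm⟩
      · exact ⟨a, e.symm⟩
    apply Set.Subset.antisymm hsub
    rintro _ ⟨a, rfl⟩
    obtain ⟨b, hb⟩ := hsub ⟨a, rfl⟩
    exact ⟨b, by simp only [hb]; exact affSwap_involutive c _⟩

lemma exists_fin_eq_add_mul (a : ℤ) : ∃ (j : Fin (k + 1)) (t : ℤ), a = (j : ℕ) + (k + 1) * t := by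
  have h0 : 0 ≤ a % (k + 1 : ℤ) := Int.emod_nonneg _ (by omega)
  have h1 : a % (k + 1 : ℤ) < k + 1 := Int.emod_lt_of_pos _ (by omega)
  refine ⟨⟨(a % (k + 1 : ℤ)).toNat, by omega⟩, a / (k + 1), ?_⟩
  simp only [Int.toNat_of_nonneg h0]
  exact (Int.emod_add_mul_ediv a (k + 1)).symm

/-- Starting from the least entry `g 0`, the representative of the next class is at least `g 0` and
at most the next integer, so the congruence forces it to be that integer. The entries are thus
consecutive, and the normalised sum gives `g 0 = 0`. -/
lemma IsWindow.eq_id_of_le {g : Fin (k + 1) → ℤ} (hg : IsWindow g)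
    (h : ∀ a b, (k + 1 : ℤ) ∣ g b - g a - 1 → g b ≤ g a + 1) : ∀ i, g i = (i : ℕ) := by
  have step : ∀ t : ℕ, t ≤ k → ∃ i, g i = g 0 + t := by
    intro t
    induction t with
    | zero => exact fun _ => ⟨0, by simp⟩
    | succ t ih =>
      intro ht
      obtain ⟨a, ha⟩ := ih (by omega)
      obtain ⟨b, hb⟩ := hg.residue.exists_dvd (g a + 1)
      rw [← sub_sub] at hb
      have h1 := h a b hb
      have h2 : g 0 ≤ g b := hg.strictMono.monotone (Fin.zero_le b)
      have := eq_zero_of_dvd_of_lt hb (by omega) (by omega)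
      exact ⟨b, by push_cast; omega⟩
  choose f hf using fun t : Fin (k + 1) => step t (by omega)
  have fmono : StrictMono f := by
    intro s t hst
    rw [← hg.strictMono.lt_iff_lt, hf, hf]
    have : (s : ℕ) < t := hst
    omega
  have fid : ∀ t, f t = t := fun t => by
    have : f = id := (fmono.range_inj strictMono_id).mp (by
      rw [Set.range_id]
      exact (Finite.injective_iff_surjective.mp fmono.injective).range_eq)
    rw [this]; rfl
  have hg' : ∀ t, g t = g 0 + (t : ℕ) := fun t => by rw [← hf t, fid]
  have hs := hg.sum
  rw [Finset.sum_congr rfl fun i _ => hg' i, Finset.sum_add_distrib] at hs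
  simp only [Finset.sum_const, Finset.card_univ, Fintype.card_fin, nsmul_eq_mul] at hs
  have : ((k + 1 : ℕ) : ℤ) * g 0 = 0 := by linarith
  have h0 : g 0 = 0 := by
    rcases mul_eq_zero.mp this with h | h
    · push_cast at h; omega
    · exact h
  intro i
  rw [hg' i, h0, zero_add]

/-! ### Words in the generators and their windows -/

variable [NeZero k]

/-- The affine transposition as a permutation. -/
def affSwapPerm (k : ℕ) [NeZero k] (c : ℤ) : Equiv.Perm ℤ := (affSwap_involutive (k := k) c).toPerm

/-- The affine permutation given by a word. -/
def wordPerm (l : List (Fin (k + 1))) : Equiv.Perm ℤ :=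
  (l.map fun i => affSwapPerm k ((i : ℕ) : ℤ)).prod

/-- The window of the affine permutation given by a word. -/
def wordWindow (l : List (Fin (k + 1))) (j : Fin (k + 1)) : ℤ := wordPerm l ((j : ℕ) : ℤ)

lemma wordPerm_cons (i : Fin (k + 1)) (l : List (Fin (k + 1))) (a : ℤ) :
    wordPerm (i :: l) a = affSwap k ((i : ℕ) : ℤ) (wordPerm l a) := by
  rfl

lemma wordPerm_add_mul (l : List (Fin (k + 1))) (a t : ℤ) :
    wordPerm l (a + (k + 1) * t) = wordPerm l a + (k + 1) * t := by
  induction l with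
  | nil => simp [wordPerm]
  | cons i l ih => rw [wordPerm_cons, wordPerm_cons, ih, affSwap_add_mul]

lemma isResidueSystem_wordWindow (l : List (Fin (k + 1))) : IsResidueSystem (wordWindow l) := by
  induction l with
  | nil => exact isResidueSystem_id
  | cons i l ih =>
    exact ih.map_affSwap ((i : ℕ) : ℤ)

lemma sum_wordWindow (l : List (Fin (k + 1))) :
    ∑ j, wordWindow l j = ∑ j : Fin (k + 1), ((j : ℕ) : ℤ) := by
  induction l with
  | nil => rfl
  | cons i l ih =>
    rw [← ih, ← (isResidueSystem_wordWindow l).sum_affSwap ((i : ℕ) : ℤ)]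
    simp only [wordWindow, wordPerm_cons]

/-- Every window is the window of a word. -/
lemma IsWindow.exists_word {g : Fin (k + 1) → ℤ} (hg : IsWindow g) :
    ∃ l : List (Fin (k + 1)), wordWindow l = g := by
  -- Descent on the sum of squares, whose end point is the window of the identity.
  induction hN : (∑ i, (g i) ^ 2).toNat using Nat.strong_induction_on generalizing g with
  | _ N ih =>
  by_cases H : ∀ a b, (k + 1 : ℤ) ∣ g b - g a - 1 → g b ≤ g a + 1
  · exact ⟨[], funext fun j => (hg.eq_id_of_le H j).symm⟩
  · push Not at H
    -- Here `g b` lies in the class following that of `g a` but beyond `g a + 1`. The swap moves the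
    -- two entries towards each other, which lowers the sum of squares. It reverses no order, since
    -- the only candidates for exchanged neighbours are `g a` and `g b`.
    obtain ⟨a, b, hab, hlt⟩ := H
    have hw : IsWindow (fun i => affSwap k (g b) (g i)) := by
      apply hg.map_affSwap
      intro i j hij hj
      have hjb := hg.residue _ _ hj
      subst hjb
      have : i = a := by
        apply hg.residue
        rwa [show g i - g a = g j - g a - 1 by omega]
      subst this
      omega
    have hne : a ≠ b := by rintro rfl; omega
    have ha : affSwap k (g b) (g a) = g a + 1 := by
      apply affSwap_of_dvd_succ
      rw [show g a + 1 - g b = -(g b - g a - 1) by ring]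
      exact hab.neg_right
    have hb : affSwap k (g b) (g b) = g b - 1 := affSwap_of_dvd (by simp)
    have hother : ∀ i, i ≠ a → i ≠ b → affSwap k (g b) (g i) = g i := by
      intro i hia hib
      apply affSwap_of_not
      · intro h
        apply hia
        apply hg.residue
        rw [show g i - g a = (g i + 1 - g b) + (g b - g a - 1) by ring]
        exact dvd_add h hab
      · exact fun h => hib (hg.residue _ _ h)
    have hlt' : ∑ i, (affSwap k (g b) (g i)) ^ 2 < ∑ i, (g i) ^ 2 := by
      rw [← Finset.add_sum_erase _ _ (Finset.mem_univ a),
        ← Finset.add_sum_erase _ _ (Finset.mem_univ a),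
        ← Finset.add_sum_erase _ _ (Finset.mem_erase.mpr ⟨hne.symm, Finset.mem_univ b⟩),
        ← Finset.add_sum_erase _ (fun i => (g i) ^ 2)
          (Finset.mem_erase.mpr ⟨hne.symm, Finset.mem_univ b⟩)]
      rw [Finset.sum_congr rfl (g := fun i => (g i) ^ 2) (fun i hi => by
        simp only [Finset.mem_erase] at hi
        rw [hother i hi.2.1 hi.1]), ha, hb]
      nlinarith
    have hpos : 0 ≤ ∑ i, (affSwap k (g b) (g i)) ^ 2 :=
      Finset.sum_nonneg fun i _ => sq_nonneg _
    obtain ⟨l, hl⟩ := ih _ (by rw [← hN]; omega) hw rfl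
    obtain ⟨c, hc⟩ := exists_fin_affSwap (k := k) (g b)
    refine ⟨c :: l, funext fun j => ?_⟩
    have := congrFun hl j
    simp only [wordWindow] at this ⊢
    rw [wordPerm_cons, this, ← hc]
    exact affSwap_involutive _ _

end

end KBounded

namespace KBounded

/-! ### Beads of a partition and cores -/

lemma lt_colLen_iff_lt_rowLen (mu : YoungDiagram) {r c : ℕ} :
    r < mu.colLen c ↔ c < mu.rowLen r := by
  rw [← YoungDiagram.mem_iff_lt_colLen, YoungDiagram.mem_iff_lt_rowLen]

lemma eq_of_rowLen_eq {mu nu : YoungDiagram} (h : ∀ r, mu.rowLen r = nu.rowLen r) : mu = nu := by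
  ext ⟨r, c⟩
  rw [YoungDiagram.mem_cells, YoungDiagram.mem_cells, YoungDiagram.mem_iff_lt_rowLen,
    YoungDiagram.mem_iff_lt_rowLen, h]

lemma rowLen_eq_zero_of_le {mu : YoungDiagram} {r : ℕ} (h : mu.colLen 0 ≤ r) :
    mu.rowLen r = 0 := by
  by_contra h0
  have := (lt_colLen_iff_lt_rowLen mu (r := r) (c := 0)).mpr (Nat.pos_of_ne_zero h0)
  omega

lemma exists_rowLen_eq {f : ℕ → ℕ} (hf : Antitone f) {N : ℕ} (hN : f N = 0) :
    ∃ mu : YoungDiagram, ∀ r, mu.rowLen r = f r := by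
  let mu : YoungDiagram :=
    { cells := (Finset.range N ×ˢ Finset.range (f 0)).filter fun x => x.2 < f x.1
      isLowerSet := by
        rintro ⟨a, b⟩ ⟨c, d⟩ ⟨h1, h2⟩ h
        simp only [Finset.coe_filter, Finset.mem_product, Finset.mem_range,
          Set.mem_ofPred_eq] at h h1 h2 ⊢
        have := hf h1
        omega }
  refine ⟨mu, fun r => eq_of_forall_lt_iff fun c => ?_⟩
  rw [← YoungDiagram.mem_iff_lt_rowLen, ← YoungDiagram.mem_cells]
  simp only [mu, Finset.mem_filter, Finset.mem_product, Finset.mem_range]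
  refine ⟨fun h => h.2, fun h => ⟨⟨?_, ?_⟩, h⟩⟩
  · by_contra hr
    have := hf (not_lt.mp hr)
    omega
  · exact h.trans_le (hf (Nat.zero_le r))

/-- The beads of `mu`: `bead mu r` is the content of the last cell in row `r`, or `-r-1` if the
row is empty. -/
def bead (mu : YoungDiagram) (r : ℕ) : ℤ := (mu.rowLen r : ℤ) - r - 1

/-- The set of all beads of `mu`. -/
def beadSet (mu : YoungDiagram) : Set ℤ := Set.range (bead mu)

lemma bead_strictAnti (mu : YoungDiagram) : StrictAnti (bead mu) := by
  intro r s h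
  have := mu.rowLen_anti r s h.le
  unfold bead
  omega

lemma bead_mem (mu : YoungDiagram) (r : ℕ) : bead mu r ∈ beadSet mu := ⟨r, rfl⟩

lemma eq_of_beadSet_eq {mu nu : YoungDiagram} (h : beadSet mu = beadSet nu) : mu = nu := by
  have h1 : StrictMono (fun r => OrderDual.toDual (bead mu r)) :=
    fun r s hrs => bead_strictAnti mu hrs
  have h2 : StrictMono (fun r => OrderDual.toDual (bead nu r)) :=
    fun r s hrs => bead_strictAnti nu hrs
  have h3 := (h1.range_inj h2).mp h
  refine eq_of_rowLen_eq fun r => ?_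
  have h4 : bead mu r = bead nu r := congrFun h3 r
  unfold bead at h4
  omega

/-- Beads strictly decrease with the row, so only the row directly above can occupy the next
position. -/
lemma bead_add_one_mem_iff (mu : YoungDiagram) (r : ℕ) :
    bead mu r + 1 ∈ beadSet mu ↔ ∃ s, s + 1 = r ∧ mu.rowLen s = mu.rowLen r := by
  constructor
  · rintro ⟨s, hs⟩
    have hlt : s < r := (bead_strictAnti mu).lt_iff_gt.mp (by omega)
    have := mu.rowLen_anti s r hlt.le
    unfold bead at hs
    exact ⟨s, by omega, by omega⟩
  · rintro ⟨s, rfl, hs⟩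
    exact ⟨s, by unfold bead; push_cast; omega⟩

lemma bead_sub_one_mem_iff (mu : YoungDiagram) (r : ℕ) :
    bead mu r - 1 ∈ beadSet mu ↔ mu.rowLen (r + 1) = mu.rowLen r := by
  constructor
  · rintro ⟨s, hs⟩
    have hlt : r < s := (bead_strictAnti mu).lt_iff_gt.mp (by omega)
    have := mu.rowLen_anti r s hlt.le
    unfold bead at hs
    have : s = r + 1 := by omega
    subst this
    push_cast at hs
    omega
  · intro h
    exact ⟨r + 1, by unfold bead; push_cast; omega⟩

/-- Adding a cell to a row moves its bead up by one, which is possible exactly when the next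
position is vacant. Removal is the same with the position below. -/
lemma isAddable_iff (mu : YoungDiagram) (r c : ℕ) :
    IsAddable mu (r, c) ↔ c = mu.rowLen r ∧ bead mu r + 1 ∉ beadSet mu := by
  rw [bead_add_one_mem_iff]
  unfold IsAddable
  rw [YoungDiagram.mem_iff_lt_rowLen]
  constructor
  · rintro ⟨h1, h2⟩
    have hc : c = mu.rowLen r := by
      have := h2 (a := (r, c)) (b := (r, mu.rowLen r)) ⟨le_rfl, not_lt.mp h1⟩ (Set.mem_insert _ _)
      simp only [Set.mem_insert_iff, Prod.mk.injEq, Finset.mem_coe, YoungDiagram.mem_cells,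
        YoungDiagram.mem_iff_lt_rowLen, true_and] at this
      omega
    refine ⟨hc, ?_⟩
    rintro ⟨s, rfl, hs⟩
    have := h2 (a := (s + 1, c)) (b := (s, c)) ⟨Nat.le_succ s, le_rfl⟩ (Set.mem_insert _ _)
    simp only [Set.mem_insert_iff, Prod.mk.injEq, Finset.mem_coe, YoungDiagram.mem_cells,
      YoungDiagram.mem_iff_lt_rowLen] at this
    omega
  · rintro ⟨rfl, h⟩
    refine ⟨lt_irrefl _, ?_⟩
    rintro a ⟨r', c'⟩ hba ha
    rcases ha with rfl | ha
    · obtain ⟨h1, h2⟩ := hba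
      simp only at h1 h2
      simp only [Set.mem_insert_iff, Prod.mk.injEq, Finset.mem_coe, YoungDiagram.mem_cells,
        YoungDiagram.mem_iff_lt_rowLen]
      have h3 := mu.rowLen_anti r' r h1
      rcases Nat.lt_or_ge c' (mu.rowLen r) with hc | hc
      · omega
      · rcases Nat.eq_or_lt_of_le h1 with rfl | hr
        · omega
        · right
          have h4 := mu.rowLen_anti r' (r - 1) (by omega)
          have h5 := mu.rowLen_anti (r - 1) r (by omega)
          have h6 : mu.rowLen (r - 1) ≠ mu.rowLen r := fun h' => h ⟨r - 1, by omega, h'⟩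
          omega
    · exact Or.inr (mu.isLowerSet hba ha)

lemma isRemovable_iff (mu : YoungDiagram) (r c : ℕ) :
    IsRemovable mu (r, c) ↔ c + 1 = mu.rowLen r ∧ bead mu r - 1 ∉ beadSet mu := by
  rw [bead_sub_one_mem_iff]
  unfold IsRemovable
  rw [YoungDiagram.mem_iff_lt_rowLen]
  constructor
  · rintro ⟨h1, h2⟩
    constructor
    · by_contra hc
      have := h2 (a := (r, c + 1)) (b := (r, c)) ⟨le_rfl, Nat.le_succ c⟩
        ⟨by simp only [Finset.mem_coe, YoungDiagram.mem_cells, YoungDiagram.mem_iff_lt_rowLen]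
            omega, by simp⟩
      exact this.2 rfl
    · intro h
      have := h2 (a := (r + 1, c)) (b := (r, c)) ⟨Nat.le_succ r, le_rfl⟩
        ⟨by simp only [Finset.mem_coe, YoungDiagram.mem_cells, YoungDiagram.mem_iff_lt_rowLen]
            omega, by simp⟩
      exact this.2 rfl
  · rintro ⟨h1, h2⟩
    refine ⟨by omega, ?_⟩
    rintro ⟨r', c'⟩ b hba ⟨ha, hne⟩
    refine ⟨mu.isLowerSet hba ha, ?_⟩
    rintro rfl
    obtain ⟨h3, h4⟩ := hba
    simp only [Finset.mem_coe, YoungDiagram.mem_cells, YoungDiagram.mem_iff_lt_rowLen,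
      Set.mem_singleton_iff, Prod.mk.injEq] at ha hne h3 h4
    have h5 := mu.rowLen_anti r r' h3
    rcases Nat.eq_or_lt_of_le h3 with rfl | hr
    · omega
    · have h6 := mu.rowLen_anti (r + 1) r' hr
      have h7 := mu.rowLen_anti r (r + 1) (by omega)
      omega

lemma hasContent_iff {k : ℕ} (i : Fin (k + 1)) (r c : ℕ) :
    HasContent i (r, c) ↔ (k + 1 : ℤ) ∣ (c : ℤ) - r - (i : ℕ) := by
  unfold HasContent
  rw [Int.modEq_comm, Int.modEq_iff_dvd]
  push_cast
  rfl

section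

variable {k : ℕ}

/-! ### The action of the generators on beads -/

lemma bead_addCells (i : Fin (k + 1)) (mu : YoungDiagram) (r : ℕ) :
    ((k + 1 : ℤ) ∣ bead mu r + 1 - (i : ℕ) ∧ bead mu r + 1 ∉ beadSet mu →
      bead (addCells i mu) r = bead mu r + 1) ∧
    (¬ ((k + 1 : ℤ) ∣ bead mu r + 1 - (i : ℕ) ∧ bead mu r + 1 ∉ beadSet mu) →
      bead (addCells i mu) r = bead mu r) := by
  have key : ∀ c, c < (addCells i mu).rowLen r ↔ c < mu.rowLen r ∨ (c = mu.rowLen r ∧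
      ((k + 1 : ℤ) ∣ bead mu r + 1 - (i : ℕ) ∧ bead mu r + 1 ∉ beadSet mu)) := by
    intro c
    rw [← YoungDiagram.mem_iff_lt_rowLen, mem_addCells, YoungDiagram.mem_iff_lt_rowLen,
      isAddable_iff, hasContent_iff]
    apply or_congr_right
    constructor
    · rintro ⟨⟨rfl, h⟩, h'⟩
      refine ⟨rfl, ?_, h⟩
      unfold bead
      rwa [sub_add_cancel]
    · rintro ⟨rfl, h, h'⟩
      unfold bead at h
      rw [sub_add_cancel] at h
      exact ⟨⟨rfl, h'⟩, h⟩
  constructor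
  · intro h
    have : (addCells i mu).rowLen r = mu.rowLen r + 1 := by
      refine eq_of_forall_lt_iff fun c => ?_
      rw [key, and_iff_left h]
      omega
    unfold bead
    push_cast [this]
    ring
  · intro h
    have : (addCells i mu).rowLen r = mu.rowLen r := by
      refine eq_of_forall_lt_iff fun c => ?_
      rw [key]
      simp only [h, and_false, or_false]
    unfold bead
    rw [this]

lemma bead_removeCells (i : Fin (k + 1)) (mu : YoungDiagram) (r : ℕ) :
    ((k + 1 : ℤ) ∣ bead mu r - (i : ℕ) ∧ bead mu r - 1 ∉ beadSet mu →
      bead (removeCells i mu) r = bead mu r - 1) ∧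
    (¬ ((k + 1 : ℤ) ∣ bead mu r - (i : ℕ) ∧ bead mu r - 1 ∉ beadSet mu) →
      bead (removeCells i mu) r = bead mu r) := by
  have key : ∀ c, c < (removeCells i mu).rowLen r ↔ c < mu.rowLen r ∧ ¬ (c + 1 = mu.rowLen r ∧
      ((k + 1 : ℤ) ∣ bead mu r - (i : ℕ) ∧ bead mu r - 1 ∉ beadSet mu)) := by
    intro c
    rw [← YoungDiagram.mem_iff_lt_rowLen, mem_removeCells, YoungDiagram.mem_iff_lt_rowLen,
      isRemovable_iff, hasContent_iff, and_assoc, and_comm (a := bead mu r - 1 ∉ beadSet mu)]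
    apply and_congr_right
    intro hc
    apply not_congr
    apply and_congr_right
    intro hc'
    have : bead mu r = (c : ℤ) - r := by
      unfold bead
      omega
    rw [this]
  constructor
  · intro h
    have hpos : 0 < mu.rowLen r := by
      by_contra h0
      have := mu.rowLen_anti r (r + 1) (by omega)
      exact h.2 ((bead_sub_one_mem_iff mu r).mpr (by omega))
    have : (removeCells i mu).rowLen r + 1 = mu.rowLen r := by
      have : (removeCells i mu).rowLen r = mu.rowLen r - 1 := by
        refine eq_of_forall_lt_iff fun c => ?_
        rw [key, and_iff_left h]
        omega
      omega
    unfold bead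
    rw [← this]
    push_cast
    ring
  · intro h
    have : (removeCells i mu).rowLen r = mu.rowLen r := by
      refine eq_of_forall_lt_iff fun c => ?_
      rw [key]
      simp only [h, and_false, not_false_eq_true, and_true]
    unfold bead
    rw [this]

/-- The bead set of `mu` is closed under subtraction of `k + 1`. -/
def BeadClosed (k : ℕ) (mu : YoungDiagram) : Prop :=
  ∀ b ∈ beadSet mu, b - (k + 1) ∈ beadSet mu

lemma BeadClosed.sub_mul_mem {mu : YoungDiagram} (h : BeadClosed k mu) {b : ℤ}
    (hb : b ∈ beadSet mu) (t : ℕ) : b - (k + 1) * t ∈ beadSet mu := by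
  induction t with
  | zero => simpa using hb
  | succ t ih =>
    have := h _ ih
    rwa [show b - (k + 1) * ((t + 1 : ℕ) : ℤ) = b - (k + 1) * t - (k + 1) by push_cast; ring]

lemma BeadClosed.mem_of_le {mu : YoungDiagram} (h : BeadClosed k mu) {b a : ℤ}
    (hb : b ∈ beadSet mu) (hab : a ≤ b) (hd : (k + 1 : ℤ) ∣ b - a) : a ∈ beadSet mu := by
  obtain ⟨t, ht⟩ := hd
  have h0 : 0 ≤ t := by
    by_contra hneg
    have : (k + 1 : ℤ) * t < 0 := mul_neg_of_pos_of_neg (by omega) (by omega)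
    omega
  have := h.sub_mul_mem hb t.toNat
  rw [Int.toNat_of_nonneg h0] at this
  rwa [show a = b - (k + 1) * t by linarith]

/-- The bead set of a core with an addable cell of content `i` is stable under removing cells of
content `i`, and conversely. -/
lemma BeadClosed.not_add_and_remove {mu : YoungDiagram} (h : BeadClosed k mu) {i b b' : ℤ}
    (hb : b ∈ beadSet mu) (hbi : (k + 1 : ℤ) ∣ b + 1 - i) (hb1 : b + 1 ∉ beadSet mu)
    (hb' : b' ∈ beadSet mu) (hbi' : (k + 1 : ℤ) ∣ b' - i) : b' - 1 ∈ beadSet mu := by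
  rcases le_or_gt (b' - 1) b with hle | hlt
  · refine h.mem_of_le hb hle ?_
    rw [show b - (b' - 1) = (b + 1 - i) - (b' - i) by ring]
    exact dvd_sub hbi hbi'
  · refine absurd (h.mem_of_le hb' (by omega) ?_) hb1
    rw [show b' - (b + 1) = (b' - i) - (b + 1 - i) by ring]
    exact dvd_sub hbi' hbi

lemma beadSet_bot : beadSet ⊥ = {a : ℤ | a < 0} := by
  have : ∀ r, bead ⊥ r = -(r : ℤ) - 1 := by
    intro r
    have : (⊥ : YoungDiagram).rowLen r = 0 := by
      by_contra h
      exact YoungDiagram.notMem_bot _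
        (YoungDiagram.mem_iff_lt_rowLen.mpr (Nat.pos_of_ne_zero h))
    simp [bead, this]
  ext a
  constructor
  · rintro ⟨r, rfl⟩
    rw [this]
    simp only [Set.mem_ofPred_eq]
    omega
  · intro ha
    simp only [Set.mem_ofPred_eq] at ha
    exact ⟨(-a - 1).toNat, by rw [this]; omega⟩

lemma beadClosed_bot : BeadClosed k ⊥ := by
  intro b hb
  rw [beadSet_bot] at hb ⊢
  simp only [Set.mem_ofPred_eq] at hb ⊢
  omega

variable [NeZero k]

/-- By `BeadClosed.not_add_and_remove`, addable and removable cells of the same residue never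
coexist. Hence in either case of the definition every bead that can move under the transposition
does move, and two occupied neighbouring positions are exchanged without changing the set. -/
lemma beadSet_coreAct (i : Fin (k + 1)) {mu : YoungDiagram} (h : BeadClosed k mu) :
    beadSet (coreAct i mu) = affSwap k (i : ℕ) '' beadSet mu := by
  unfold coreAct
  split_ifs with hadd
  · obtain ⟨⟨r, c⟩, hx, hc⟩ := hadd
    rw [isAddable_iff] at hx
    obtain ⟨rfl, hx⟩ := hx
    rw [hasContent_iff] at hc
    have hrem : ∀ b ∈ beadSet mu, (k + 1 : ℤ) ∣ b - (i : ℕ) → b - 1 ∈ beadSet mu := by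
      intro b hb hbi
      refine h.not_add_and_remove (bead_mem mu r) ?_ hx hb hbi
      unfold bead
      rwa [sub_add_cancel]
    apply Set.Subset.antisymm
    · rintro _ ⟨s, rfl⟩
      rcases affSwap_cases (k := k) (i : ℕ) (bead mu s) with ⟨h1, h2, e⟩ | ⟨h1, h2, e⟩ | ⟨h1, h2, e⟩
      · by_cases hm : bead mu s + 1 ∈ beadSet mu
        · rw [(bead_addCells i mu s).2 (by simp [hm])]
          exact ⟨_, hm, by rw [affSwap_of_dvd h1]; ring⟩
        · rw [(bead_addCells i mu s).1 ⟨h1, hm⟩]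
          exact ⟨_, bead_mem mu s, e⟩
      · rw [(bead_addCells i mu s).2 (by simp [h2])]
        exact ⟨_, hrem _ (bead_mem mu s) h1, by
          rw [affSwap_of_dvd_succ (by rwa [sub_add_cancel])]; ring⟩
      · rw [(bead_addCells i mu s).2 (by simp [h1])]
        exact ⟨_, bead_mem mu s, e⟩
    · rintro _ ⟨_, ⟨s, rfl⟩, rfl⟩
      rcases affSwap_cases (k := k) (i : ℕ) (bead mu s) with ⟨h1, h2, e⟩ | ⟨h1, h2, e⟩ | ⟨h1, h2, e⟩
      · rw [e]
        by_cases hm : bead mu s + 1 ∈ beadSet mu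
        · obtain ⟨t, ht⟩ := hm
          rw [← ht] at h1 ⊢
          exact ⟨t, (bead_addCells i mu t).2 fun hh => not_dvd_both hh.1 h1⟩
        · exact ⟨s, (bead_addCells i mu s).1 ⟨h1, hm⟩⟩
      · rw [e]
        obtain ⟨t, ht⟩ := hrem _ (bead_mem mu s) h1
        rw [← ht]
        refine ⟨t, (bead_addCells i mu t).2 fun hh => hh.2 ?_⟩
        rw [ht, sub_add_cancel]
        exact bead_mem mu s
      · rw [e]
        exact ⟨s, (bead_addCells i mu s).2 fun hh => h1 hh.1⟩
  · have hno : ∀ b ∈ beadSet mu, (k + 1 : ℤ) ∣ b + 1 - (i : ℕ) → b + 1 ∈ beadSet mu := by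
      rintro _ ⟨r, rfl⟩ hbi
      by_contra hb
      refine hadd ⟨(r, mu.rowLen r), (isAddable_iff _ _ _).mpr ⟨rfl, hb⟩,
        (hasContent_iff _ _ _).mpr ?_⟩
      unfold bead at hbi
      rwa [sub_add_cancel] at hbi
    apply Set.Subset.antisymm
    · rintro _ ⟨s, rfl⟩
      rcases affSwap_cases (k := k) (i : ℕ) (bead mu s) with ⟨h1, h2, e⟩ | ⟨h1, h2, e⟩ | ⟨h1, h2, e⟩
      · rw [(bead_removeCells i mu s).2 (by simp [h2])]
        exact ⟨_, hno _ (bead_mem mu s) h1, by rw [affSwap_of_dvd h1]; ring⟩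
      · by_cases hm : bead mu s - 1 ∈ beadSet mu
        · rw [(bead_removeCells i mu s).2 (by simp [hm])]
          exact ⟨_, hm, by rw [affSwap_of_dvd_succ (by rwa [sub_add_cancel])]; ring⟩
        · rw [(bead_removeCells i mu s).1 ⟨h1, hm⟩]
          exact ⟨_, bead_mem mu s, e⟩
      · rw [(bead_removeCells i mu s).2 (by simp [h2])]
        exact ⟨_, bead_mem mu s, e⟩
    · rintro _ ⟨_, ⟨s, rfl⟩, rfl⟩
      rcases affSwap_cases (k := k) (i : ℕ) (bead mu s) with ⟨h1, h2, e⟩ | ⟨h1, h2, e⟩ | ⟨h1, h2, e⟩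
      · rw [e]
        obtain ⟨t, ht⟩ := hno _ (bead_mem mu s) h1
        rw [← ht]
        refine ⟨t, (bead_removeCells i mu t).2 fun hh => hh.2 ?_⟩
        rw [ht, add_sub_cancel_right]
        exact bead_mem mu s
      · rw [e]
        by_cases hm : bead mu s - 1 ∈ beadSet mu
        · obtain ⟨t, ht⟩ := hm
          rw [← ht]
          refine ⟨t, (bead_removeCells i mu t).2 fun hh => ?_⟩
          rw [ht] at hh
          exact not_dvd_both (a := bead mu s - 1) (by rwa [sub_add_cancel]) hh.1
        · exact ⟨s, (bead_removeCells i mu s).1 ⟨h1, hm⟩⟩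
      · rw [e]
        exact ⟨s, (bead_removeCells i mu s).2 fun hh => h2 hh.1⟩

lemma BeadClosed.coreAct {mu : YoungDiagram} (h : BeadClosed k mu) (i : Fin (k + 1)) :
    BeadClosed k (coreAct i mu) := by
  intro b hb
  rw [beadSet_coreAct i h] at hb ⊢
  obtain ⟨a, ha, rfl⟩ := hb
  refine ⟨a - (k + 1), h a ha, ?_⟩
  have := affSwap_add_mul (k := k) (i : ℕ) a (-1)
  rw [show a - (k + 1 : ℤ) = a + (k + 1) * (-1) by ring, this]
  ring

lemma beadClosed_wordCore (l : List (Fin (k + 1))) : BeadClosed k (wordCore l) := by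
  induction l with
  | nil => exact beadClosed_bot
  | cons i l ih => exact ih.coreAct i

lemma beadSet_wordCore (l : List (Fin (k + 1))) :
    beadSet (wordCore l) = wordPerm l '' {a : ℤ | a < 0} := by
  induction l with
  | nil =>
    rw [show wordCore ([] : List (Fin (k + 1))) = ⊥ from rfl, beadSet_bot]
    simp [wordPerm]
  | cons i l ih =>
    rw [show wordCore (i :: l) = coreAct i (wordCore l) from rfl,
      beadSet_coreAct i (beadClosed_wordCore l), ih, Set.image_image]
    rfl

lemma coreAct_coreAct (i : Fin (k + 1)) {mu : YoungDiagram} (h : BeadClosed k mu) :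
    KBounded.coreAct i (KBounded.coreAct i mu) = mu := by
  apply eq_of_beadSet_eq
  rw [beadSet_coreAct i (h.coreAct i), beadSet_coreAct i h, Set.image_image]
  simp [affSwap_involutive (k := k) ((i : ℕ) : ℤ) _]

/-- The last cell of the lowest non-empty row is removable, so no cell of its residue is addable and
the generator strictly shrinks the diagram. As the generator is an involution, the step can be
undone. -/
lemma BeadClosed.exists_wordCore {mu : YoungDiagram} (h : BeadClosed k mu) :
    ∃ l : List (Fin (k + 1)), wordCore l = mu := by
  induction hN : mu.card using Nat.strong_induction_on generalizing mu with
  | _ N ih =>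
  by_cases h0 : mu.colLen 0 = 0
  · refine ⟨[], eq_of_rowLen_eq fun r => ?_⟩
    rw [rowLen_eq_zero_of_le (mu := mu) (by omega)]
    by_contra hr
    exact YoungDiagram.notMem_bot _
      (YoungDiagram.mem_iff_lt_rowLen.mpr (Nat.pos_of_ne_zero hr))
  · obtain ⟨r, hr⟩ := Nat.exists_eq_succ_of_ne_zero h0
    have h1 : 0 < mu.rowLen r := (lt_colLen_iff_lt_rowLen mu).mp (by omega)
    have h2 : mu.rowLen (r + 1) = 0 := rowLen_eq_zero_of_le (by omega)
    have h3 : bead mu r - 1 ∉ beadSet mu := by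
      rw [bead_sub_one_mem_iff]; omega
    obtain ⟨i, t, ht⟩ := exists_fin_eq_add_mul (k := k) (bead mu r)
    have hi : (k + 1 : ℤ) ∣ bead mu r - (i : ℕ) := ⟨t, by rw [ht]; ring⟩
    have hcard : (KBounded.coreAct i mu).card < mu.card := by
      unfold KBounded.coreAct
      rw [if_neg]
      · apply Finset.card_lt_card
        rw [Finset.ssubset_iff_of_subset (fun x hx => ?_)]
        · refine ⟨(r, mu.rowLen r - 1), ?_, ?_⟩
          · rw [YoungDiagram.mem_cells, YoungDiagram.mem_iff_lt_rowLen]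
            omega
          · rw [YoungDiagram.mem_cells, mem_removeCells]
            intro hx
            refine hx.2 ⟨(isRemovable_iff _ _ _).mpr ⟨by omega, h3⟩, (hasContent_iff _ _ _).mpr ?_⟩
            unfold bead at hi
            rwa [Nat.cast_sub (by omega), Nat.cast_one, sub_right_comm (mu.rowLen r : ℤ)]
        · rw [YoungDiagram.mem_cells, mem_removeCells] at hx
          exact hx.1
      · rintro ⟨⟨s, c⟩, hx, hc⟩
        rw [isAddable_iff] at hx
        obtain ⟨rfl, hx⟩ := hx
        rw [hasContent_iff] at hc
        refine h3 (h.not_add_and_remove (bead_mem mu s) ?_ hx (bead_mem mu r) hi)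
        unfold bead
        rwa [sub_add_cancel]
    obtain ⟨l, hl⟩ := ih _ (by rw [← hN]; exact hcard) (h.coreAct i) rfl
    exact ⟨i :: l, by rw [← coreAct_coreAct i h, ← hl]; rfl⟩

end

/-! ### The correspondence between cores and bounded partitions -/

lemma hook_eq {mu : YoungDiagram} {r c : ℕ} (h : c < mu.rowLen r) :
    r < mu.colLen c ∧ hook mu r c + r + c + 1 = mu.rowLen r + mu.colLen c := by
  have := (lt_colLen_iff_lt_rowLen mu).mpr h
  unfold hook
  omega

lemma hook_anti {mu : YoungDiagram} {r c d : ℕ} (hcd : c ≤ d) (h : d < mu.rowLen r) :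
    hook mu r d ≤ hook mu r c := by
  have h1 := hook_eq h
  have h2 := hook_eq (mu := mu) (r := r) (c := c) (by omega)
  have := mu.colLen_anti c d hcd
  omega

/-- Hook lengths weakly decrease along a row, so the long hooks fill an initial segment of some
length `c₀`. -/
lemma exists_card_hook (k : ℕ) (mu : YoungDiagram) (r : ℕ) :
    ∃ c₀ ≤ mu.rowLen r, (∀ c < c₀, k + 1 ≤ hook mu r c) ∧
      (∀ c, c₀ ≤ c → c < mu.rowLen r → hook mu r c < k + 1) ∧
      ((Finset.range (mu.rowLen r)).filter fun c => hook mu r c < k + 1).card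
        = mu.rowLen r - c₀ := by
  have hex : ∃ c, mu.rowLen r ≤ c ∨ hook mu r c < k + 1 := ⟨mu.rowLen r, Or.inl le_rfl⟩
  classical
  have hs := Nat.find_spec hex
  have hmin := fun c (h : c < Nat.find hex) => Nat.find_min hex h
  have hle : Nat.find hex ≤ mu.rowLen r := Nat.find_min' hex (Or.inl le_rfl)
  generalize Nat.find hex = c₀ at hs hmin hle
  have h1 : ∀ c < c₀, k + 1 ≤ hook mu r c := fun c hc => by
    have := hmin c hc
    omega
  have h2 : ∀ c, c₀ ≤ c → c < mu.rowLen r → hook mu r c < k + 1 := fun c hc hc' => by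
    have := hook_anti (mu := mu) (r := r) hc hc'
    omega
  refine ⟨c₀, hle, h1, h2, ?_⟩
  rw [← Nat.card_Ico]
  congr 1
  ext c
  simp only [Finset.mem_filter, Finset.mem_range, Finset.mem_Ico]
  constructor
  · rintro ⟨h3, h4⟩
    refine ⟨?_, h3⟩
    by_contra h5
    have := h1 c (by omega)
    omega
  · rintro ⟨h3, h4⟩
    exact ⟨h4, h2 c h3 h4⟩

/-- With the length k+1 excluded, the last long hook has length at least k+2, so its column reaches
row r+(k+1-L). The column of the first short hook stops before that row. Hence the row there has
exactly as many cells as row r has long hooks. -/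
lemma IsCore.rowLen_eq {k : ℕ} {mu : YoungDiagram} (h : IsCore k mu) (r L : ℕ)
    (hL : L = ((Finset.range (mu.rowLen r)).filter fun c => hook mu r c < k + 1).card) :
    L ≤ k ∧ mu.rowLen r = L + mu.rowLen (r + (k + 1 - L)) := by
  obtain ⟨c₀, h0, h1, h2, h3⟩ := exists_card_hook k mu r
  rw [h3] at hL
  have hk : L ≤ k := by
    by_contra hlt
    have h4 := h2 c₀ le_rfl (by omega)
    have h5 := hook_eq (mu := mu) (r := r) (c := c₀) (by omega)
    omega
  refine ⟨hk, ?_⟩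
  have hge : c₀ ≤ mu.rowLen (r + (k + 1 - L)) := by
    rcases Nat.eq_zero_or_pos c₀ with hz | hp
    · omega
    · have h4 := h1 (c₀ - 1) (by omega)
      have h5 := hook_eq (mu := mu) (r := r) (c := c₀ - 1) (by omega)
      have h6 := h r (c₀ - 1) (YoungDiagram.mem_iff_lt_rowLen.mpr (by omega))
      have h7 := (lt_colLen_iff_lt_rowLen mu (r := r + (k + 1 - L)) (c := c₀ - 1)).mp (by omega)
      omega
  have hle : mu.rowLen (r + (k + 1 - L)) ≤ c₀ := by
    rcases Nat.eq_zero_or_pos L with hz | hp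
    · have := mu.rowLen_anti r (r + (k + 1 - L)) (by omega)
      omega
    · have h4 := h2 c₀ le_rfl (by omega)
      have h5 := hook_eq (mu := mu) (r := r) (c := c₀) (by omega)
      have h7 := (lt_colLen_iff_lt_rowLen mu (r := r + (k + 1 - L)) (c := c₀)).not.mp (by omega)
      omega
  omega

/-- A partition `mu` is the core of `lam` if and only if its rows satisfy a recursion. -/
lemma isCoreOf_iff {k : ℕ} {mu lam : YoungDiagram} :
    IsCoreOf k mu lam ↔ ∀ r, lam.rowLen r ≤ k ∧
      mu.rowLen r = lam.rowLen r + mu.rowLen (r + (k + 1 - lam.rowLen r)) := by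
  constructor
  · rintro ⟨h1, h2⟩ r
    exact h1.rowLen_eq r _ (h2 r)
  · intro h
    have hbig : ∀ r c, c < mu.rowLen (r + (k + 1 - lam.rowLen r)) → k + 1 < hook mu r c := by
      intro r c hc
      have h1 := h r
      have h2 := hook_eq (mu := mu) (r := r) (c := c) (by omega)
      have h3 := (lt_colLen_iff_lt_rowLen mu).mpr hc
      omega
    have hsmall : ∀ r c, mu.rowLen (r + (k + 1 - lam.rowLen r)) ≤ c → c < mu.rowLen r →
        hook mu r c < k + 1 := by
      intro r c hc hc'
      have h1 := h r
      have h2 := hook_eq hc'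
      have h3 := (lt_colLen_iff_lt_rowLen mu (r := r + (k + 1 - lam.rowLen r)) (c := c)).not.mpr
        (by omega)
      omega
    constructor
    · intro r c hrc
      rw [YoungDiagram.mem_iff_lt_rowLen] at hrc
      rcases Nat.lt_or_ge c (mu.rowLen (r + (k + 1 - lam.rowLen r))) with hc | hc
      · have := hbig r c hc
        omega
      · have := hsmall r c hc hrc
        omega
    · intro r
      have h1 := h r
      trans (Finset.Ico (mu.rowLen (r + (k + 1 - lam.rowLen r))) (mu.rowLen r)).card
      · rw [Nat.card_Ico]
        omega
      · congr 1
        ext c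
        simp only [Finset.mem_filter, Finset.mem_range, Finset.mem_Ico]
        constructor
        · rintro ⟨h3, h4⟩
          exact ⟨h4, hsmall r c h3 h4⟩
        · rintro ⟨h3, h4⟩
          refine ⟨?_, h3⟩
          by_contra h5
          have := hbig r c (by omega)
          omega

/-- The row recursion in terms of beads: it locates the row of the bead k+1 positions lower. This is
how the closure of the bead set and the parts of the bounded partition determine each other. -/
lemma IsCoreOf.bead_eq {k : ℕ} {mu lam : YoungDiagram} (h : IsCoreOf k mu lam) (r : ℕ) :
    bead mu (r + (k + 1 - lam.rowLen r)) = bead mu r - (k + 1) := by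
  have := isCoreOf_iff.mp h r
  unfold bead
  push_cast [Nat.cast_sub (show lam.rowLen r ≤ k + 1 by omega)]
  omega

lemma IsCoreOf.beadClosed {k : ℕ} {mu lam : YoungDiagram} (h : IsCoreOf k mu lam) :
    BeadClosed k mu := by
  rintro _ ⟨r, rfl⟩
  rw [← h.bead_eq r]
  exact bead_mem _ _

lemma IsCoreOf.isKBounded {k : ℕ} {mu lam : YoungDiagram} (h : IsCoreOf k mu lam) :
    IsKBounded k lam := fun r => (isCoreOf_iff.mp h r).1

lemma BeadClosed.exists_isCoreOf {k : ℕ} {mu : YoungDiagram} (h : BeadClosed k mu) :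
    ∃ lam, IsCoreOf k mu lam := by
  -- `t r` is the row of the bead lying k+1 below that of row `r`. By the recursion the part of
  -- index `r` has to be k+1-(t r - r), which `hlen` identifies with a difference of row lengths. It
  -- decreases weakly because `t` is strictly increasing.
  choose t ht using fun r => h _ (bead_mem mu r)
  have hlt : ∀ r, r < t r := fun r =>
    (bead_strictAnti mu).lt_iff_gt.mp (by rw [ht]; omega)
  have hlen : ∀ r, mu.rowLen r + t r = k + 1 + mu.rowLen (t r) + r := by
    intro r
    have h1 := ht r
    unfold bead at h1
    omega
  have htm : ∀ r, t r < t (r + 1) := fun r =>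
    (bead_strictAnti mu).lt_iff_gt.mp (by
      rw [ht, ht]
      have := bead_strictAnti mu (Nat.lt_succ_self r)
      simp only [Nat.succ_eq_add_one] at this
      omega)
  have hanti : Antitone fun r => mu.rowLen r - mu.rowLen (t r) := by
    refine antitone_nat_of_succ_le fun r => ?_
    have h1 := hlen r
    have h2 := hlen (r + 1)
    have h3 := htm r
    have h4 := mu.rowLen_anti r (t r) (hlt r).le
    have h5 := mu.rowLen_anti (r + 1) (t (r + 1)) (hlt (r + 1)).le
    omega
  obtain ⟨lam, hlam⟩ := exists_rowLen_eq hanti (N := mu.colLen 0) (by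
    simp [rowLen_eq_zero_of_le (mu := mu) le_rfl])
  refine ⟨lam, isCoreOf_iff.mpr fun r => ?_⟩
  rw [hlam]
  have h1 := hlen r
  have h2 := hlt r
  have h4 := mu.rowLen_anti r (t r) (hlt r).le
  have h5 : r + (k + 1 - (mu.rowLen r - mu.rowLen (t r))) = t r := by omega
  rw [h5]
  omega

/-- The recursion expresses a row through a strictly lower one, so the core is determined from the
bottom upwards. -/
lemma IsCoreOf.core_unique {k : ℕ} {mu nu lam : YoungDiagram} (h : IsCoreOf k mu lam)
    (h' : IsCoreOf k nu lam) : mu = nu := by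
  rw [isCoreOf_iff] at h h'
  refine eq_of_rowLen_eq fun r => ?_
  induction hN : (max (mu.colLen 0) (nu.colLen 0) - r) using Nat.strong_induction_on
    generalizing r with
  | _ N ih =>
  by_cases hr : max (mu.colLen 0) (nu.colLen 0) ≤ r
  · rw [rowLen_eq_zero_of_le (mu := mu) (by omega), rowLen_eq_zero_of_le (mu := nu) (by omega)]
  · have h1 := h r
    rw [h1.2, (h' r).2, ih _ _ _ rfl]
    omega

lemma IsCoreOf.partition_unique {k : ℕ} {mu lam lam' : YoungDiagram} (h : IsCoreOf k mu lam)
    (h' : IsCoreOf k mu lam') : lam = lam' :=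
  eq_of_rowLen_eq fun r => (h.2 r).trans (h'.2 r).symm

/-- The row lengths of the core of the bounded partition with parts `f r`, `r < N`. -/
def coreRow (k N : ℕ) (f : ℕ → ℕ) (r : ℕ) : ℕ :=
  if _h : r < N ∧ f r ≤ k then f r + coreRow k N f (r + (k + 1 - f r)) else 0
termination_by N - r
decreasing_by omega

lemma exists_core {k : ℕ} {lam : YoungDiagram} (h : IsKBounded k lam) :
    ∃ mu, IsCoreOf k mu lam := by
  have h0 : ∀ r, lam.colLen 0 ≤ r → coreRow k (lam.colLen 0) lam.rowLen r = 0 := by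
    intro r hr
    rw [coreRow, dif_neg]
    omega
  have hanti : ∀ r s, r ≤ s →
      coreRow k (lam.colLen 0) lam.rowLen s ≤ coreRow k (lam.colLen 0) lam.rowLen r := by
    intro r
    induction hN : lam.colLen 0 - r using Nat.strong_induction_on generalizing r with
    | _ N ih =>
    intro s hrs
    by_cases hs : lam.colLen 0 ≤ s
    · rw [h0 s hs]; exact Nat.zero_le _
    · rw [coreRow, dif_pos ⟨by omega, h s⟩]
      conv_rhs => rw [coreRow, dif_pos ⟨by omega, h r⟩]
      have h1 := lam.rowLen_anti r s hrs
      have h2 := h r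
      -- Since the parts decrease, the row to which the recursion refers increases with the row it
      -- starts from.
      have h3 := ih _ (by omega) (r + (k + 1 - lam.rowLen r)) rfl
        (s + (k + 1 - lam.rowLen s)) (by omega)
      omega
  obtain ⟨mu, hmu⟩ := exists_rowLen_eq (f := coreRow k (lam.colLen 0) lam.rowLen)
    (fun r s hrs => hanti r s hrs) (N := lam.colLen 0) (h0 _ le_rfl)
  refine ⟨mu, isCoreOf_iff.mpr fun r => ⟨h r, ?_⟩⟩
  rw [hmu, hmu]
  by_cases hr : r < lam.colLen 0
  · conv_lhs => rw [coreRow, dif_pos ⟨hr, h r⟩]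
  · rw [h0 r (by omega), h0 _ (by omega), rowLen_eq_zero_of_le (by omega)]

end KBounded

namespace KBounded

/-! ### Coordinates on `V k` and the description of alcoves by windows -/

section

variable {k : ℕ}

/-- The coefficients of `x` with respect to the simple roots, extended by `0`. -/
def rootCoeff (x : V k) : ℕ → ℝ
  | 0 => 0
  | a + 1 => if h : a < k then x ⟨a, h⟩ else 0

/-- The coordinates of `x` when `V k` is realised as the sum-zero hyperplane of `ℝ^(k+1)`. -/
def coord (x : V k) (r : ℕ) : ℝ := rootCoeff x (r + 1) - rootCoeff x r

lemma rootCoeff_succ (x : V k) (i : Fin k) : rootCoeff x (i + 1) = x i := by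
  simp [rootCoeff]

lemma rootCoeff_last (x : V k) : rootCoeff x (k + 1) = 0 := by
  simp [rootCoeff]

lemma form_simpleRoot_eq_coord (i : Fin k) (x : V k) :
    form k (simpleRoot i) x = coord x i - coord x (i + 1) := by
  rw [form_simpleRoot]
  -- `sum_cartan` expects a function of a real variable, so the coefficients are read through the
  -- floor. The shift by one sends -1 and k to the vanishing coefficients of index 0 and k+1.
  have h := sum_cartan k i (fun t => rootCoeff x (⌊t⌋ + 1).toNat)
    (by
      have : (⌊(-1 : ℝ)⌋ + 1).toNat = 0 := by
        rw [show (-1 : ℝ) = ((-1 : ℤ) : ℝ) by norm_num, Int.floor_intCast]; rfl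
      simp only [this, rootCoeff])
    (by
      have : (⌊(k : ℝ)⌋ + 1).toNat = k + 1 := by rw [Int.floor_natCast]; omega
      simp only [this, rootCoeff_last])
  have e : ∀ j : Fin k, rootCoeff x (⌊(j : ℝ)⌋ + 1).toNat = x j := by
    intro j
    rw [Int.floor_natCast, show ((j : ℕ) + 1 : ℤ).toNat = (j : ℕ) + 1 by omega, rootCoeff_succ]
  have e1 : (⌊((i : ℕ) : ℝ) + 1⌋ + 1).toNat = i + 1 + 1 := by
    rw [Int.floor_add_one, Int.floor_natCast]; omega
  have e2 : (⌊((i : ℕ) : ℝ) - 1⌋ + 1).toNat = i := by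
    rw [Int.floor_sub_one, Int.floor_natCast]; omega
  simp only [e, e1, e2] at h
  rw [h]
  unfold coord
  rw [rootCoeff_succ]
  ring

lemma form_highestRoot_eq_coord (x : V k) :
    form k (highestRoot k) x = coord x 0 - coord x k := by
  unfold highestRoot
  rw [map_sum, LinearMap.sum_apply, Finset.sum_congr rfl fun i _ => form_simpleRoot_eq_coord i x,
    Fin.sum_univ_eq_sum_range (fun i => coord x i - coord x (i + 1)), Finset.sum_range_sub']

lemma rootCoeff_sub_smul (x y : V k) (t : ℝ) (a : ℕ) :
    rootCoeff (x - t • y) a = rootCoeff x a - t * rootCoeff y a := by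
  cases a with
  | zero => simp [rootCoeff]
  | succ a =>
    simp only [rootCoeff]
    split_ifs <;> simp

lemma coord_sub_smul (x y : V k) (t : ℝ) (a : ℕ) :
    coord (x - t • y) a = coord x a - t * coord y a := by
  unfold coord
  rw [rootCoeff_sub_smul, rootCoeff_sub_smul]
  ring

lemma rootCoeff_simpleRoot (i : Fin k) (a : ℕ) :
    rootCoeff (simpleRoot i) a = if a = i + 1 then 1 else 0 := by
  cases a with
  | zero => simp [rootCoeff]
  | succ a =>
    simp only [rootCoeff, simpleRoot]
    split_ifs with h1 h2 h2
    · have : (⟨a, h1⟩ : Fin k) = i := Fin.ext (by simpa using h2)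
      rw [this, Pi.single_eq_same]
    · apply Pi.single_eq_of_ne
      rintro rfl
      exact h2 rfl
    · omega
    · rfl

lemma rootCoeff_highestRoot (a : ℕ) :
    rootCoeff (highestRoot k) a = if 1 ≤ a ∧ a ≤ k then 1 else 0 := by
  cases a with
  | zero => simp [rootCoeff]
  | succ a =>
    have : ∀ j, highestRoot k j = 1 := by
      intro j
      simp [highestRoot, simpleRoot, Finset.sum_apply, Pi.single_apply]
    simp only [rootCoeff]
    split_ifs with h1 h2 h2
    · exact this _
    · omega
    · omega
    · rfl

lemma coord_simpleRoot (i : Fin k) (a : ℕ) :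
    coord (simpleRoot i) a = if a = i then 1 else if a = i + 1 then -1 else 0 := by
  unfold coord
  rw [rootCoeff_simpleRoot, rootCoeff_simpleRoot]
  split_ifs <;> first | omega | norm_num

lemma coord_highestRoot [NeZero k] {a : ℕ} (ha : a ≤ k) :
    coord (highestRoot k) a = if a = 0 then 1 else if a = k then -1 else 0 := by
  have hk : 0 < k := Nat.pos_of_ne_zero (NeZero.ne k)
  unfold coord
  rw [rootCoeff_highestRoot, rootCoeff_highestRoot]
  split_ifs <;> first | omega | norm_num

lemma gen_succ_apply (i : Fin k) (x : V k) :
    gen i.succ x = x - (coord x i - coord x (i + 1)) • simpleRoot i := by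
  have : gen i.succ x = x - (2 * (form k (simpleRoot i) x - 0) /
    form k (simpleRoot i) (simpleRoot i)) • simpleRoot i := rfl
  rw [this]
  congr 2
  rw [form_simpleRoot_eq_coord, form_simpleRoot_eq_coord, coord_simpleRoot, coord_simpleRoot,
    if_pos rfl, if_neg (by omega), if_pos rfl]
  ring

lemma gen_zero_apply [NeZero k] (x : V k) :
    gen 0 x = x - (coord x 0 - coord x k - 1) • highestRoot k := by
  have : gen 0 x = x - (2 * (form k (highestRoot k) x - 1) /
    form k (highestRoot k) (highestRoot k)) • highestRoot k := rfl
  rw [this]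
  congr 2
  rw [form_highestRoot_eq_coord, form_highestRoot_eq_coord, coord_highestRoot (Nat.zero_le k),
    coord_highestRoot le_rfl, if_pos rfl, if_neg (NeZero.ne k), if_pos rfl]
  ring

lemma gen_mul_gen (i : Fin (k + 1)) : (gen i : Equiv.Perm (V k)) * gen i = 1 := by
  ext1 x
  rw [Equiv.Perm.mul_apply, Equiv.Perm.one_apply]
  refine Fin.cases ?_ (fun j => ?_) i
  · exact (reflection (highestRoot k) 1).left_inv x
  · exact (reflection (simpleRoot j) 0).left_inv x

/-- The extension of the coordinates of `x` to a function on `ℤ` that decreases by `1` under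
translation by `k + 1`. -/
noncomputable def affCoord (x : V k) (a : ℤ) : ℝ :=
  coord x (a % (k + 1)).toNat - ((a / (k + 1) : ℤ) : ℝ)

lemma affCoord_eq (x : V k) {j : ℕ} (hj : j ≤ k) (t : ℤ) :
    affCoord x ((j : ℤ) + (k + 1) * t) = coord x j - t := by
  have h1 : ((j : ℤ) + (k + 1) * t) % (k + 1) = j := by
    rw [Int.add_mul_emod_self_left, Int.emod_eq_of_lt (by omega) (by omega)]
  have h2 : ((j : ℤ) + (k + 1) * t) / (k + 1) = t := by
    rw [Int.add_mul_ediv_left _ _ (by omega), Int.ediv_eq_zero_of_lt (by omega) (by omega),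
      zero_add]
  unfold affCoord
  rw [h1, h2, Int.toNat_natCast]

/-- A reflection in a simple root exchanges two neighbouring coordinates. The affine reflection
exchanges the first and the last one with a shift by 1, which quasi-periodicity turns into an
exchange of neighbours across the boundary of a period. -/
lemma affCoord_gen [NeZero k] (i : Fin (k + 1)) (x : V k) (a : ℤ) :
    affCoord (gen i x) a = affCoord x (affSwap k (i : ℕ) a) := by
  have hk : 0 < k := Nat.pos_of_ne_zero (NeZero.ne k)
  obtain ⟨⟨j, hj⟩, t, rfl⟩ := exists_fin_eq_add_mul (k := k) a
  rw [affSwap_add_mul]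
  simp only
  rw [affCoord_eq _ (by omega)]
  refine Fin.cases ?_ (fun i => ?_) i
  · rw [gen_zero_apply, coord_sub_smul, coord_highestRoot (by omega)]
    simp only [Fin.val_zero, Nat.cast_zero]
    rcases affSwap_cases (k := k) 0 (j : ℤ) with ⟨h1, h2, e⟩ | ⟨h1, h2, e⟩ | ⟨h1, h2, e⟩
    · have hjk : j = k := by
        by_contra hne
        have := eq_zero_of_dvd_of_lt h1 (by omega) (by omega)
        omega
      subst hjk
      rw [e, if_neg hk.ne', if_pos rfl, show ((j : ℤ) + 1 + (j + 1) * t)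
        = ((0 : ℕ) : ℤ) + (j + 1) * (t + 1) by push_cast; ring, affCoord_eq _ (Nat.zero_le _)]
      push_cast
      ring
    · have hj0 : j = 0 := by
        have := eq_zero_of_dvd_of_lt h1 (by omega) (by omega)
        omega
      subst hj0
      rw [e, if_pos rfl, show (((0 : ℕ) : ℤ) - 1 + (k + 1) * t)
        = (k : ℤ) + (k + 1) * (t - 1) by push_cast; ring, affCoord_eq _ le_rfl]
      push_cast
      ring
    · rw [e, affCoord_eq _ (by omega), if_neg, if_neg]
      · ring
      · rintro rfl
        exact h1 (by simp)
      · rintro rfl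
        exact h2 (by simp)
  · rw [gen_succ_apply, coord_sub_smul, coord_simpleRoot]
    simp only [Fin.val_succ]
    rcases affSwap_cases (k := k) ((i + 1 : ℕ) : ℤ) (j : ℤ) with
      ⟨h1, h2, e⟩ | ⟨h1, h2, e⟩ | ⟨h1, h2, e⟩
    · have hji : j = i := by
        have := eq_zero_of_dvd_of_lt h1 (by omega) (by omega)
        omega
      rw [e, if_pos hji, show ((j : ℤ) + 1 + (k + 1) * t)
        = ((j + 1 : ℕ) : ℤ) + (k + 1) * t by push_cast; ring, affCoord_eq _ (by omega), hji]
      ring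
    · have hji : j = i + 1 := by
        have := eq_zero_of_dvd_of_lt h1 (by omega) (by omega)
        omega
      rw [e, if_neg (by omega), if_pos hji, show ((j : ℤ) - 1 + (k + 1) * t)
        = ((i : ℕ) : ℤ) + (k + 1) * t by push_cast [hji]; ring, affCoord_eq _ (by omega), hji]
      ring
    · rw [e, affCoord_eq _ (by omega), if_neg, if_neg]
      · ring
      · rintro rfl
        exact h2 (by simp)
      · rintro rfl
        exact h1 (by simp)

lemma affCoord_word [NeZero k] (l : List (Fin (k + 1))) (x : V k) (a : ℤ) :
    affCoord ((l.map gen).prod x) (wordPerm l a) = affCoord x a := by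
  induction l with
  | nil => rfl
  | cons i l ih =>
    rw [List.map_cons, List.prod_cons, Equiv.Perm.mul_apply, affCoord_gen, wordPerm_cons,
      affSwap_involutive, ih]

/-- The walls compare neighbouring extended coordinates: the simple roots inside a period, the
highest root across its boundary. -/
lemma mem_fundamentalAlcove_iff (x : V k) :
    x ∈ fundamentalAlcove k ↔ Antitone (affCoord x) := by
  have hx : x ∈ fundamentalAlcove k ↔
      (∀ i : Fin k, coord x (i + 1) ≤ coord x i) ∧ coord x 0 - 1 ≤ coord x k := by
    simp only [fundamentalAlcove, dominantChamber, Set.mem_ofPred_eq, form_simpleRoot_eq_coord,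
      form_highestRoot_eq_coord, sub_nonneg]
    exact and_congr_right fun _ => ⟨fun h => by linarith, fun h => by linarith⟩
  rw [hx]
  constructor
  · rintro ⟨h1, h2⟩
    refine antitone_int_of_succ_le fun a => ?_
    obtain ⟨⟨j, hj⟩, t, rfl⟩ := exists_fin_eq_add_mul (k := k) a
    simp only
    rw [affCoord_eq _ (by omega)]
    rcases Nat.lt_or_ge j k with hjk | hjk
    · rw [show ((j : ℤ) + (k + 1) * t + 1) = ((j + 1 : ℕ) : ℤ) + (k + 1) * t by push_cast; ring,
        affCoord_eq _ (by omega)]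
      have := h1 ⟨j, hjk⟩
      simp only at this
      linarith
    · obtain rfl : j = k := by omega
      rw [show ((j : ℤ) + (j + 1) * t + 1) = ((0 : ℕ) : ℤ) + (j + 1) * (t + 1) by push_cast; ring,
        affCoord_eq _ (by omega)]
      push_cast
      linarith
  · intro h
    constructor
    · intro i
      have := h (show ((i : ℕ) : ℤ) + (k + 1) * 0 ≤ ((i + 1 : ℕ) : ℤ) + (k + 1) * 0 by
        push_cast; omega)
      rw [affCoord_eq _ (by omega), affCoord_eq _ (by omega)] at this
      linarith
    · have := h (show (k : ℤ) + (k + 1) * 0 ≤ ((0 : ℕ) : ℤ) + (k + 1) * 1 by push_cast; omega)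
      rw [affCoord_eq _ (by omega), affCoord_eq _ (by omega)] at this
      push_cast at this
      linarith

/-! ### Alcoves as systems of inequalities between coordinates -/

lemma mem_alcove_iff (w : Equiv.Perm (V k)) (x : V k) :
    x ∈ alcove w ↔ w x ∈ fundamentalAlcove k := by
  unfold alcove
  constructor
  · rintro ⟨y, hy, rfl⟩
    simpa using hy
  · intro h
    exact ⟨w x, h, by simp⟩

/-- The alcove with window `g`. -/
def windowAlcove (g : Fin (k + 1) → ℤ) : Set (V k) :=
  {x | ∀ (i j : Fin (k + 1)) (t : ℤ), g i ≤ g j + (k + 1) * t → coord x j - t ≤ coord x i}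

/-- A point lies in the alcove of w when its image under w has antitone extended coordinates. By
`affCoord_word` these are the extended coordinates of the point read along w⁻¹, and by
quasi-periodicity it suffices to compare positions `i` and `j + (k+1)t` with `i`, `j` in one period.
-/
lemma alcove_word [NeZero k] (l : List (Fin (k + 1))) :
    alcove (l.map gen).prod = windowAlcove (wordWindow l) := by
  ext x
  rw [mem_alcove_iff, mem_fundamentalAlcove_iff]
  constructor
  · intro h i j t hij
    have h1 : wordPerm l (((i : ℕ) : ℤ) + (k + 1) * 0)
        ≤ wordPerm l (((j : ℕ) : ℤ) + (k + 1) * t) := by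
      rw [wordPerm_add_mul, wordPerm_add_mul, mul_zero, add_zero]
      exact hij
    have h2 := h h1
    rw [affCoord_word, affCoord_word, affCoord_eq _ (by omega), affCoord_eq _ (by omega)] at h2
    simpa using h2
  · intro h a b hab
    obtain ⟨a, rfl⟩ := (wordPerm l).surjective a
    obtain ⟨b, rfl⟩ := (wordPerm l).surjective b
    rw [affCoord_word, affCoord_word]
    obtain ⟨i, s, rfl⟩ := exists_fin_eq_add_mul (k := k) a
    obtain ⟨j, t, rfl⟩ := exists_fin_eq_add_mul (k := k) b
    rw [wordPerm_add_mul, wordPerm_add_mul] at hab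
    rw [affCoord_eq _ (by omega), affCoord_eq _ (by omega)]
    have := h i j (t - s) (by unfold wordWindow; linarith)
    push_cast at this
    linarith

lemma sum_coord (x : V k) : ∑ i : Fin (k + 1), coord x i = 0 := by
  rw [Fin.sum_univ_eq_sum_range (fun i => coord x i)]
  unfold coord
  rw [Finset.sum_range_sub, rootCoeff_last]
  simp [rootCoeff]

lemma exists_coord_eq {X : Fin (k + 1) → ℝ} (hX : ∑ i, X i = 0) :
    ∃ x : V k, ∀ i : Fin (k + 1), coord x i = X i := by
  let Y : ℕ → ℝ := fun a => if h : a < k + 1 then X ⟨a, h⟩ else 0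
  have hY : ∀ i : Fin (k + 1), Y i = X i := fun i => dif_pos i.isLt
  have hsum : ∑ a ∈ Finset.range (k + 1), Y a = 0 := by
    rw [← hX, ← Fin.sum_univ_eq_sum_range]
    exact Finset.sum_congr rfl fun i _ => hY i
  let x : V k := fun j => ∑ a ∈ Finset.range (j + 1), Y a
  have hc : ∀ a, a ≤ k + 1 → rootCoeff x a = ∑ b ∈ Finset.range a, Y b := by
    intro a ha
    cases a with
    | zero => simp [rootCoeff]
    | succ a =>
      simp only [rootCoeff]
      split_ifs with h
      · rfl
      · obtain rfl : a = k := by omega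
        exact hsum.symm
  refine ⟨x, fun i => ?_⟩
  unfold coord
  rw [hc _ (by omega), hc _ (by omega), Finset.sum_range_succ, add_sub_cancel_left, hY]

lemma coord_injective {x y : V k} (h : ∀ i : Fin (k + 1), coord x i = coord y i) : x = y := by
  have hc : ∀ a, a ≤ k + 1 → rootCoeff x a = rootCoeff y a := by
    intro a
    induction a with
    | zero => simp [rootCoeff]
    | succ a ih =>
      intro ha
      have h1 := h ⟨a, by omega⟩
      have h2 := ih (by omega)
      unfold coord at h1
      simp only at h1
      linarith
  funext i
  rw [← rootCoeff_succ x, ← rootCoeff_succ y]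
  exact hc _ (by omega)

/-- The centre of the alcove with window `g`. -/
lemma exists_center {g : Fin (k + 1) → ℤ} (hg : ∑ i, g i = ∑ i : Fin (k + 1), ((i : ℕ) : ℤ)) :
    ∃ x : V k, x ∈ windowAlcove g ∧ ∀ (i j : Fin (k + 1)) (t : ℤ),
      coord x j - t ≤ coord x i → g i ≤ g j + (k + 1) * t := by
  have hk : (0 : ℝ) < k + 1 := by positivity
  -- The coordinates are `-g i / (k+1)`, recentred to have sum zero. The extended coordinate at a
  -- position is then a decreasing affine function of the window value there, extended by periods,
  -- so both orders agree without ties.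
  obtain ⟨x, hx⟩ := exists_coord_eq (k := k)
    (X := fun i => ((∑ i : Fin (k + 1), ((i : ℕ) : ℝ)) / (k + 1) - g i) / (k + 1)) (by
      rw [← Finset.sum_div, Finset.sum_sub_distrib, Finset.sum_const, Finset.card_univ,
        Fintype.card_fin, nsmul_eq_mul, ← Int.cast_sum, hg]
      push_cast
      rw [mul_div_cancel₀ _ hk.ne', sub_self, zero_div])
  have key : ∀ (i j : Fin (k + 1)) (t : ℤ),
      coord x j - t ≤ coord x i ↔ g i ≤ g j + (k + 1) * t := by
    intro i j t
    rw [hx, hx, ← sub_nonneg]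
    rw [show ((∑ i : Fin (k + 1), ((i : ℕ) : ℝ)) / (k + 1) - g i) / (k + 1) -
      (((∑ i : Fin (k + 1), ((i : ℕ) : ℝ)) / (k + 1) - g j) / (k + 1) - t) =
      ((g j + (k + 1) * t : ℤ) - (g i : ℝ)) / (k + 1) by push_cast; field_simp; ring]
    rw [le_div_iff₀ hk, zero_mul, sub_nonneg, Int.cast_le]
  exact ⟨x, fun i j t h => (key i j t).mpr h, fun i j t h => (key i j t).mp h⟩

lemma windowAlcove_subset_dominantChamber {g : Fin (k + 1) → ℤ} (hg : StrictMono g) :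
    windowAlcove g ⊆ dominantChamber k := by
  intro x hx i
  rw [form_simpleRoot_eq_coord, sub_nonneg]
  have := hx i.castSucc i.succ 0 (by
    rw [mul_zero, add_zero]
    exact (hg i.castSucc_lt_succ).le)
  simpa using this

/-- Dominance is tested at the centre, whose coordinates reflect the order of the entries
faithfully; incongruence makes the inequalities strict. -/
lemma isWindow_of_subset_dominantChamber {g : Fin (k + 1) → ℤ} (hr : IsResidueSystem g)
    (hs : ∑ i, g i = ∑ i : Fin (k + 1), ((i : ℕ) : ℤ))
    (h : windowAlcove g ⊆ dominantChamber k) : IsWindow g where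
  strictMono := by
    obtain ⟨x, hx, hx'⟩ := exists_center hs
    refine Fin.strictMono_iff_lt_succ.mpr fun i => ?_
    have h1 := h hx i
    rw [form_simpleRoot_eq_coord, sub_nonneg] at h1
    have h2 := hx' i.castSucc i.succ 0 (by simpa using h1)
    rw [mul_zero, add_zero] at h2
    refine lt_of_le_of_ne h2 fun h3 => ?_
    have := hr i.castSucc i.succ (by rw [h3, sub_self]; exact dvd_zero _)
    exact i.castSucc_lt_succ.ne this
  residue := hr
  sum := hs

lemma IsWindow.highestRoot_le_iff [NeZero k] {g : Fin (k + 1) → ℤ} (hg : IsWindow g) (m : ℕ) :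
    (∀ x ∈ windowAlcove g, form k (highestRoot k) x ≤ m) ↔
      g (Fin.last k) < g 0 + (k + 1) * m := by
  simp only [form_highestRoot_eq_coord]
  constructor
  · intro h
    obtain ⟨x, hx, hx'⟩ := exists_center hg.sum
    have h1 := h x hx
    have h2 := hx' (Fin.last k) 0 m (by
      simp only [Fin.val_zero, Fin.val_last, Int.cast_natCast]; linarith)
    -- Equality would make the first and the last entry congruent modulo k+1, although k > 0.
    refine lt_of_le_of_ne h2 fun h3 => ?_
    have := hg.residue (Fin.last k) 0 ⟨m, by rw [h3]; ring⟩
    exact NeZero.ne k (by simpa using congrArg Fin.val this)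
  · intro h x hx
    have := hx (Fin.last k) 0 m h.le
    simp only [Fin.val_zero, Fin.val_last, Int.cast_natCast] at this
    linarith

/-- An order automorphism of ℤ is a translation. -/
lemma eq_add_of_monotone {P Q : Equiv.Perm ℤ} (h : ∀ a b, P a ≤ P b → Q a ≤ Q b) :
    ∃ c, ∀ a, Q a = P a + c := by
  have hlt : ∀ a b, P a < P b → Q a < Q b := fun a b hab =>
    lt_of_le_of_ne (h a b hab.le) fun h' => hab.ne (congrArg P (Q.injective h'))
  let R : Equiv.Perm ℤ := Q * P⁻¹
  have hR : ∀ a, Q a = R (P a) := fun a => by simp [R]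
  have hmono : StrictMono R := by
    intro a b hab
    obtain ⟨a, rfl⟩ := P.surjective a
    obtain ⟨b, rfl⟩ := P.surjective b
    rw [← hR, ← hR]
    exact hlt a b hab
  have hstep : ∀ a, R (a + 1) = R a + 1 := by
    intro a
    have h1 := hmono (show a < a + 1 by omega)
    obtain ⟨b, hb⟩ := R.surjective (R a + 1)
    have h2 : a < b := hmono.lt_iff_lt.mp (by omega)
    have h3 : b ≤ a + 1 := hmono.le_iff_le.mp (by omega)
    have : b = a + 1 := by omega
    rw [← this, hb]
  refine ⟨R 0, fun a => ?_⟩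
  rw [hR]
  generalize P a = b
  induction b using Int.induction_on with
  | zero => simp
  | succ i ih => rw [hstep, ih]; ring
  | pred i ih =>
    have := hstep (-i - 1)
    rw [sub_add_cancel, ih] at this
    linarith

/-- The centre of one alcove lies in the other, so both affine permutations order ℤ in the same way
and differ by a translation. The normalised sum makes the translation trivial. -/
lemma windowAlcove_injective [NeZero k] {g g' : Fin (k + 1) → ℤ} (hg : IsWindow g)
    (hg' : IsWindow g') (h : windowAlcove g = windowAlcove g') : g = g' := by
  obtain ⟨l, rfl⟩ := hg.exists_word
  obtain ⟨l', rfl⟩ := hg'.exists_word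
  obtain ⟨x, hx, hx'⟩ := exists_center hg.sum
  rw [h] at hx
  obtain ⟨c, hc⟩ := eq_add_of_monotone (P := wordPerm l') (Q := wordPerm l) (by
    intro a b hab
    obtain ⟨i, s, rfl⟩ := exists_fin_eq_add_mul (k := k) a
    obtain ⟨j, t, rfl⟩ := exists_fin_eq_add_mul (k := k) b
    rw [wordPerm_add_mul, wordPerm_add_mul] at hab ⊢
    have := hx' i j (t - s) (hx i j (t - s) (by unfold wordWindow; linarith))
    unfold wordWindow at this
    linarith)
  have hs : ∑ j, wordWindow l j = ∑ j, (wordWindow l' j + c) :=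
    Finset.sum_congr rfl fun j _ => hc _
  rw [Finset.sum_add_distrib, hg.sum, hg'.sum] at hs
  simp only [Finset.sum_const, Finset.card_univ, Fintype.card_fin, nsmul_eq_mul] at hs
  have : ((k + 1 : ℕ) : ℤ) * c = 0 := by linarith
  have h0 : c = 0 := by
    rcases mul_eq_zero.mp this with h | h
    · push_cast at h; omega
    · exact h
  funext j
  have := hc ((j : ℕ) : ℤ)
  rw [h0, add_zero] at this
  exact this

lemma exists_word_of_mem_affineWeyl {w : Equiv.Perm (V k)} (hw : w ∈ affineWeyl k) :
    ∃ l : List (Fin (k + 1)), w = (l.map gen).prod := by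
  unfold affineWeyl at hw
  induction hw using Subgroup.closure_induction with
  | mem x hx =>
    obtain ⟨i, rfl⟩ := hx
    exact ⟨[i], by simp⟩
  | one => exact ⟨[], rfl⟩
  | mul x y _ _ hx hy =>
    obtain ⟨l, rfl⟩ := hx
    obtain ⟨l', rfl⟩ := hy
    exact ⟨l ++ l', by simp⟩
  | inv x _ hx =>
    obtain ⟨l, rfl⟩ := hx
    refine ⟨l.reverse, ?_⟩
    rw [List.prod_inv_reverse, List.map_reverse, List.map_map]
    congr 2
    refine List.map_congr_left fun i _ => ?_
    exact inv_eq_of_mul_eq_one_left (gen_mul_gen i)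

lemma word_mem_affineWeyl (l : List (Fin (k + 1))) :
    (l.map gen).prod ∈ affineWeyl k := by
  apply Subgroup.list_prod_mem
  intro x hx
  obtain ⟨i, -, rfl⟩ := List.mem_map.mp hx
  exact Subgroup.subset_closure ⟨i, rfl⟩

lemma mem_dominantAlcoves_iff [NeZero k] (m : ℕ) (A : Set (V k)) :
    A ∈ dominantAlcoves k m ↔ ∃ g : Fin (k + 1) → ℤ, IsWindow g ∧
      g (Fin.last k) < g 0 + (k + 1) * m ∧ A = windowAlcove g := by
  constructor
  · rintro ⟨⟨w, hw, rfl⟩, h1, h2⟩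
    obtain ⟨l, rfl⟩ := exists_word_of_mem_affineWeyl hw
    rw [alcove_word] at h1 h2 ⊢
    have hg := isWindow_of_subset_dominantChamber (isResidueSystem_wordWindow l)
      (sum_wordWindow l) h1
    exact ⟨_, hg, (hg.highestRoot_le_iff m).mp h2, rfl⟩
  · rintro ⟨g, hg, hm, rfl⟩
    obtain ⟨l, rfl⟩ := hg.exists_word
    exact ⟨⟨_, word_mem_affineWeyl l, (alcove_word l).symm⟩,
      windowAlcove_subset_dominantChamber hg.strictMono, (hg.highestRoot_le_iff m).mpr hm⟩

end

end KBounded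

namespace KBounded

/-! ### The partition attached to a window -/

section

variable {k : ℕ}

/-- The bead set of the core with window `g`. -/
def windowBeads (g : Fin (k + 1) → ℤ) : Set ℤ := {b | ∃ i, (k + 1 : ℤ) ∣ g i - b ∧ b < g i}

/-- `lam` is the bounded partition of the core with window `g`. -/
def IsShape (g : Fin (k + 1) → ℤ) (lam : YoungDiagram) : Prop :=
  ∃ mu, beadSet mu = windowBeads g ∧ IsCoreOf k mu lam

lemma windowBeads_comp (g : Fin (k + 1) → ℤ) (e : Equiv.Perm (Fin (k + 1))) :
    windowBeads (g ∘ e) = windowBeads g := by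
  ext b
  constructor
  · rintro ⟨i, hi⟩
    exact ⟨e i, hi⟩
  · rintro ⟨i, hi⟩
    exact ⟨e.symm i, by simpa using hi⟩

lemma beadSet_wordCore_eq [NeZero k] (l : List (Fin (k + 1))) :
    beadSet (wordCore l) = windowBeads (wordWindow l) := by
  rw [beadSet_wordCore]
  ext b
  constructor
  · rintro ⟨a, ha, rfl⟩
    obtain ⟨j, t, rfl⟩ := exists_fin_eq_add_mul (k := k) a
    rw [wordPerm_add_mul]
    have ht : t < 0 := by
      by_contra h0
      have : 0 ≤ (k + 1 : ℤ) * t := mul_nonneg (by omega) (by omega)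
      simp only [Set.mem_ofPred_eq] at ha
      omega
    refine ⟨j, ⟨-t, by unfold wordWindow; ring⟩, ?_⟩
    have : (k + 1 : ℤ) * t < 0 := mul_neg_of_pos_of_neg (by omega) ht
    unfold wordWindow
    omega
  · rintro ⟨j, ⟨t, ht⟩, hlt⟩
    have ht0 : 0 < t := by
      by_contra h0
      have : (k + 1 : ℤ) * t ≤ 0 := mul_nonpos_of_nonneg_of_nonpos (by omega) (by omega)
      omega
    refine ⟨(j : ℕ) + (k + 1) * (-t), ?_, ?_⟩
    · have h1 : (k + 1 : ℤ) * 1 ≤ (k + 1) * t := mul_le_mul_of_nonneg_left ht0 (by omega)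
      have h2 : ((j : ℕ) : ℤ) < k + 1 := by omega
      simp only [Set.mem_ofPred_eq]
      linarith
    · rw [wordPerm_add_mul]
      unfold wordWindow at ht
      linarith

lemma beadSet_eq_of_coreAct [NeZero k] {g : Fin (k + 1) → ℤ} {mu : YoungDiagram}
    (h : BeadClosed k mu) (hmu : beadSet mu = windowBeads g) (i : Fin (k + 1)) :
    beadSet (coreAct i mu) = windowBeads fun j => affSwap k (i : ℕ) (g j) := by
  rw [beadSet_coreAct i h, hmu]
  have key : ∀ (f : Fin (k + 1) → ℤ) (b : ℤ), b ∈ windowBeads f →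
      affSwap k (i : ℕ) b ∈ windowBeads fun j => affSwap k (i : ℕ) (f j) := by
    rintro f b ⟨j, ⟨t, ht⟩, hlt⟩
    have hb : f j = b + (k + 1) * t := by linarith
    refine ⟨j, ⟨t, ?_⟩, ?_⟩
    · simp only
      rw [hb, affSwap_add_mul]
      ring
    · simp only
      rw [hb, affSwap_add_mul]
      linarith
  apply Set.Subset.antisymm
  · rintro _ ⟨b, hb, rfl⟩
    exact key g b hb
  · intro b hb
    have := key _ b hb
    simp only [affSwap_involutive (k := k) ((i : ℕ) : ℤ) _] at this
    exact ⟨_, this, affSwap_involutive _ _⟩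

lemma IsResidueSystem.notMem_windowBeads {g : Fin (k + 1) → ℤ} (hg : IsResidueSystem g)
    (i : Fin (k + 1)) : g i ∉ windowBeads g := by
  rintro ⟨j, h1, h2⟩
  rw [hg _ _ h1] at h2
  exact lt_irrefl _ h2

/-- Each entry is recovered from the beads as the first vacant position of its class: it is vacant,
while the position k+1 below it is occupied. -/
lemma IsResidueSystem.range_subset {g g' : Fin (k + 1) → ℤ} (hg : IsResidueSystem g)
    (h : windowBeads g = windowBeads g') : Set.range g ⊆ Set.range g' := by
  rintro _ ⟨i, rfl⟩
  have h1 := hg.notMem_windowBeads i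
  have h2 : g i - (k + 1) ∈ windowBeads g := ⟨i, ⟨1, by ring⟩, by omega⟩
  rw [h] at h1 h2
  obtain ⟨j, hd, hlt⟩ := h2
  have hd' : (k + 1 : ℤ) ∣ g' j - g i := by
    rw [show g' j - g i = g' j - (g i - (k + 1)) - (k + 1) by ring]
    exact dvd_sub hd dvd_rfl
  have hle : g' j ≤ g i := by
    by_contra hh
    exact h1 ⟨j, hd', by omega⟩
  have := eq_zero_of_dvd_of_lt hd' (by omega) (by omega)
  exact ⟨j, by omega⟩

lemma IsWindow.eq_of_windowBeads_eq {g g' : Fin (k + 1) → ℤ} (hg : IsWindow g) (hg' : IsWindow g')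
    (h : windowBeads g = windowBeads g') : g = g' :=
  (hg.strictMono.range_inj hg'.strictMono).mp
    (Set.Subset.antisymm (hg.residue.range_subset h) (hg'.residue.range_subset h.symm))

lemma IsShape.unique {g : Fin (k + 1) → ℤ} {lam lam' : YoungDiagram} (h : IsShape g lam)
    (h' : IsShape g lam') : lam = lam' := by
  obtain ⟨mu, h1, h2⟩ := h
  obtain ⟨nu, h3, h4⟩ := h'
  obtain rfl := eq_of_beadSet_eq (h1.trans h3.symm)
  exact h2.partition_unique h4

lemma IsShape.window_unique {g g' : Fin (k + 1) → ℤ} {lam : YoungDiagram} (hg : IsWindow g)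
    (hg' : IsWindow g') (h : IsShape g lam) (h' : IsShape g' lam) : g = g' := by
  obtain ⟨mu, h1, h2⟩ := h
  obtain ⟨nu, h3, h4⟩ := h'
  obtain rfl := h2.core_unique h4
  exact hg.eq_of_windowBeads_eq hg' (h1.symm.trans h3)

lemma IsWindow.exists_isShape [NeZero k] {g : Fin (k + 1) → ℤ} (hg : IsWindow g) :
    ∃ lam, IsShape g lam := by
  obtain ⟨l, rfl⟩ := hg.exists_word
  obtain ⟨lam, h⟩ := (beadClosed_wordCore l).exists_isCoreOf
  exact ⟨lam, _, beadSet_wordCore_eq l, h⟩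

lemma exists_window_of_isKBounded [NeZero k] {lam : YoungDiagram} (h : IsKBounded k lam) :
    ∃ g : Fin (k + 1) → ℤ, IsWindow g ∧ IsShape g lam := by
  obtain ⟨mu, hmu⟩ := exists_core h
  obtain ⟨l, rfl⟩ := hmu.beadClosed.exists_wordCore
  have hr := isResidueSystem_wordWindow l
  -- The bead set depends only on the set of entries, so the window may be sorted.
  refine ⟨wordWindow l ∘ Tuple.sort (wordWindow l), ⟨?_, ?_, ?_⟩, _, ?_, hmu⟩
  · refine (Tuple.monotone_sort _).strictMono_of_injective fun i j hij => ?_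
    exact (Tuple.sort (wordWindow l)).injective
      (hr _ _ (by rw [show wordWindow l _ = wordWindow l _ from hij, sub_self]; exact dvd_zero _))
  · exact fun i j hij => (Tuple.sort (wordWindow l)).injective (hr _ _ hij)
  · rw [← sum_wordWindow l]
    exact Equiv.sum_comp (Tuple.sort (wordWindow l)) (wordWindow l)
  · rw [windowBeads_comp, beadSet_wordCore_eq]

/-- Dominance forces the window of the word to increase, so one and the same window describes both
the alcove and the core. -/
lemma corresponds_iff [NeZero k] (lam : YoungDiagram) (A : Set (V k)) :
    Corresponds k lam A ↔
      ∃ g : Fin (k + 1) → ℤ, IsWindow g ∧ A = windowAlcove g ∧ IsShape g lam := by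
  constructor
  · rintro ⟨h1, l, rfl, h2⟩
    rw [alcove_word] at h1 ⊢
    exact ⟨_, isWindow_of_subset_dominantChamber (isResidueSystem_wordWindow l)
      (sum_wordWindow l) h1, rfl, _, beadSet_wordCore_eq l, h2⟩
  · rintro ⟨g, hg, rfl, mu, h1, h2⟩
    refine ⟨windowAlcove_subset_dominantChamber hg.strictMono, ?_⟩
    obtain ⟨l, rfl⟩ := hg.exists_word
    obtain rfl := eq_of_beadSet_eq (h1.trans (beadSet_wordCore_eq l).symm)
    exact ⟨l, (alcove_word l).symm, h2⟩

lemma IsShape.isKBounded {g : Fin (k + 1) → ℤ} {lam : YoungDiagram} (h : IsShape g lam) :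
    IsKBounded k lam := by
  obtain ⟨mu, -, h⟩ := h
  exact h.isKBounded

lemma IsShape.colLen_eq_zero {g : Fin (k + 1) → ℤ} {lam : YoungDiagram} (h : IsShape g lam)
    {c : ℕ} (hc : k ≤ c) : lam.colLen c = 0 := by
  by_contra h0
  have h1 := (lt_colLen_iff_lt_rowLen lam (r := 0) (c := c)).mp (Nat.pos_of_ne_zero h0)
  have := h.isKBounded 0
  omega

lemma lt_card_filter_iff {g : Fin (k + 1) → ℤ} (hg : Monotone g) (b : ℤ) (c : Fin (k + 1)) :
    (c : ℕ) < (Finset.univ.filter fun i => g i < b).card ↔ g c < b := by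
  constructor
  · intro h
    by_contra hc
    have : (Finset.univ.filter fun i => g i < b) ⊆ Finset.Iio c := by
      intro i hi
      simp only [Finset.mem_filter, Finset.mem_univ, true_and] at hi
      rw [Finset.mem_Iio]
      by_contra hic
      have := hg (not_lt.mp hic)
      omega
    have := Finset.card_le_card this
    rw [Fin.card_Iio] at this
    omega
  · intro h
    have : Finset.Iic c ⊆ (Finset.univ.filter fun i => g i < b) := by
      intro i hi
      rw [Finset.mem_Iic] at hi
      simp only [Finset.mem_filter, Finset.mem_univ, true_and]
      exact (hg hi).trans_lt h
    have := Finset.card_le_card this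
    rw [Fin.card_Iic] at this
    omega

/-- By `IsCoreOf.bead_eq`, the rows from r up to but excluding r+(k+1-lam_r) carry the beads in an
interval of k+1 consecutive positions ending at `bead mu r`. A residue class has a bead there, and
then only one, exactly when its first vacancy `g i` lies above `bead mu r`. So k+1-lam_r entries lie
above this bead and the others below. -/
lemma rowLen_eq_card {g : Fin (k + 1) → ℤ} (hg : IsWindow g) {mu lam : YoungDiagram}
    (hmu : beadSet mu = windowBeads g) (h : IsCoreOf k mu lam) (r : ℕ) :
    lam.rowLen r = (Finset.univ.filter fun i => g i < bead mu r).card := by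
  have hle := (isCoreOf_iff.mp h r).1
  have hmem : ∀ s, ∃ i, (k + 1 : ℤ) ∣ g i - bead mu s ∧ bead mu s < g i := by
    intro s
    have := bead_mem mu s
    rwa [hmu] at this
  choose cls hcls hlt using hmem
  have hb := h.bead_eq r
  have hrange : ∀ s ∈ Finset.Ico r (r + (k + 1 - lam.rowLen r)),
      bead mu r - (k + 1) < bead mu s ∧ bead mu s ≤ bead mu r := by
    intro s hs
    rw [Finset.mem_Ico] at hs
    have h1 := bead_strictAnti mu hs.2
    have h2 := (bead_strictAnti mu).antitone hs.1
    rw [hb] at h1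
    exact ⟨h1, h2⟩
  have hcard : (Finset.Ico r (r + (k + 1 - lam.rowLen r))).card =
      (Finset.univ.filter fun i => ¬ g i < bead mu r).card := by
    refine Finset.card_bij (fun s _ => cls s) ?_ ?_ ?_
    · intro s hs
      have h1 := hrange s hs
      simp only [Finset.mem_filter, Finset.mem_univ, true_and]
      have := Int.le_of_dvd (by have := hlt s; omega) (hcls s)
      omega
    · intro s hs s' hs' hss
      have h1 := hrange s hs
      have h2 := hrange s' hs'
      have hd : (k + 1 : ℤ) ∣ bead mu s - bead mu s' := by
        have h3 := hcls s
        rw [hss] at h3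
        rw [show bead mu s - bead mu s' = (g (cls s') - bead mu s') - (g (cls s') - bead mu s)
          by ring]
        exact dvd_sub (hcls s') h3
      have := eq_zero_of_dvd_of_lt hd (by omega) (by omega)
      exact (bead_strictAnti mu).injective (by omega)
    · intro i hi
      simp only [Finset.mem_filter, Finset.mem_univ, true_and] at hi
      have hne : g i ≠ bead mu r := fun he => by
        have := hg.residue.notMem_windowBeads i
        rw [← hmu, he] at this
        exact this (bead_mem mu r)
      have he0 := Int.emod_nonneg (bead mu r - g i) (show (k + 1 : ℤ) ≠ 0 by omega)
      have he1 := Int.emod_lt_of_pos (bead mu r - g i) (show (0 : ℤ) < k + 1 by omega)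
      have hd : (k + 1 : ℤ) ∣ g i - (bead mu r - (bead mu r - g i) % (k + 1)) := by
        have := (Int.dvd_self_sub_emod (x := bead mu r - g i) (m := (k + 1 : ℤ))).neg_right
        rwa [show g i - (bead mu r - (bead mu r - g i) % (k + 1)) =
          -(bead mu r - g i - (bead mu r - g i) % (k + 1)) by ring]
      have hv : bead mu r - (bead mu r - g i) % (k + 1) ∈ beadSet mu := by
        rw [hmu]
        exact ⟨i, hd, by omega⟩
      obtain ⟨s, hs⟩ := hv
      refine ⟨s, ?_, ?_⟩
      · rw [Finset.mem_Ico]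
        constructor
        · exact (bead_strictAnti mu).le_iff_ge.mp (by omega)
        · exact (bead_strictAnti mu).lt_iff_gt.mp (by omega)
      · apply hg.residue
        rw [← hs] at hd
        rw [show g (cls s) - g i = (g (cls s) - bead mu s) - (g i - bead mu s) by ring]
        exact dvd_sub (hcls s) hd
  have htot := Finset.card_filter_add_card_filter_not (s := (Finset.univ : Finset (Fin (k + 1))))
    (fun i => g i < bead mu r)
  rw [← hcard, Nat.card_Ico, Finset.card_univ, Fintype.card_fin] at htot
  omega

/-- The conjugate partition in terms of the window. -/
lemma IsShape.colLen_eq {g : Fin (k + 1) → ℤ} (hg : IsWindow g) {lam : YoungDiagram}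
    (h : IsShape g lam) (c : Fin (k + 1)) :
    lam.colLen c = ∑ i, ((g i - g c) / (k + 1)).toNat := by
  obtain ⟨mu, hmu, h⟩ := h
  -- Column c thus counts the beads above `g c`. In the class of `g i` the beads are g i -
  -- (k+1)(u+1) with u ≥ 0, and those above `g c` are the ones with u < ⌊(g i - g c)/(k+1)⌋.
  have hr : ∀ r, r < lam.colLen c ↔ g c < bead mu r := by
    intro r
    rw [lt_colLen_iff_lt_rowLen, rowLen_eq_card hg hmu h,
      lt_card_filter_iff hg.strictMono.monotone]
  have hinj : Set.InjOn (fun x : (_ : Fin (k + 1)) × ℕ => g x.1 - (k + 1) * ((x.2 : ℤ) + 1))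
      ((Finset.univ.sigma fun i => Finset.range ((g i - g c) / (k + 1)).toNat :
        Finset ((_ : Fin (k + 1)) × ℕ)) : Set ((_ : Fin (k + 1)) × ℕ)) := by
    rintro ⟨i, u⟩ - ⟨j, v⟩ - huv
    simp only at huv
    obtain rfl : i = j := hg.residue _ _ ⟨(u : ℤ) - v, by linarith⟩
    have : (k + 1 : ℤ) * (u - v) = 0 := by linarith
    rcases mul_eq_zero.mp this with h | h
    · omega
    · obtain rfl : u = v := by omega
      rfl
  have himg : (Finset.range (lam.colLen c)).image (bead mu) =
      (Finset.univ.sigma fun i => Finset.range ((g i - g c) / (k + 1)).toNat).image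
        (fun x : (_ : Fin (k + 1)) × ℕ => g x.1 - (k + 1) * ((x.2 : ℤ) + 1)) := by
    ext v
    simp only [Finset.mem_image, Finset.mem_range, Finset.mem_sigma, Finset.mem_univ, true_and,
      Sigma.exists, hr]
    constructor
    · rintro ⟨r, h1, rfl⟩
      have hm := bead_mem mu r
      rw [hmu] at hm
      obtain ⟨i, ⟨t, ht⟩, hlt⟩ := hm
      have ht0 : 0 < t := by
        by_contra h0
        have : (k + 1 : ℤ) * t ≤ 0 := mul_nonpos_of_nonneg_of_nonpos (by omega) (by omega)
        omega
      refine ⟨i, (t - 1).toNat, ?_, ?_⟩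
      · have : t ≤ (g i - g c) / (k + 1) := by
          rw [Int.le_ediv_iff_mul_le (by omega)]
          linarith
        omega
      · rw [Int.toNat_of_nonneg (by omega)]
        linarith
    · rintro ⟨i, u, hu, rfl⟩
      have hu' : (u : ℤ) + 1 ≤ (g i - g c) / (k + 1) := by omega
      rw [Int.le_ediv_iff_mul_le (by omega)] at hu'
      have hm : g i - (k + 1) * ((u : ℤ) + 1) ∈ beadSet mu := by
        rw [hmu]
        refine ⟨i, ⟨(u : ℤ) + 1, by ring⟩, ?_⟩
        have : (0 : ℤ) < (k + 1) * ((u : ℤ) + 1) := by positivity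
        omega
      obtain ⟨r, hr'⟩ := hm
      refine ⟨r, ?_, hr'⟩
      rw [hr']
      refine lt_of_le_of_ne (by linarith) fun he => ?_
      have hic : c = i := hg.residue _ _ ⟨-((u : ℤ) + 1), by rw [he]; ring⟩
      subst hic
      have : (0 : ℤ) < (k + 1) * ((u : ℤ) + 1) := by positivity
      linarith
  have hc := congrArg Finset.card himg
  rw [Finset.card_image_of_injective _ (bead_strictAnti mu).injective,
    Finset.card_image_of_injOn hinj, Finset.card_range, Finset.card_sigma] at hc
  simpa using hc

lemma card_eq_sum_colLen {lam : YoungDiagram} (h : IsKBounded k lam) :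
    lam.card = ∑ c : Fin (k + 1), lam.colLen c := by
  rw [Fin.sum_univ_eq_sum_range (fun c => lam.colLen c)]
  have : ∀ x ∈ lam.cells, x.2 ∈ Finset.range (k + 1) := by
    rintro ⟨r, c⟩ hx
    rw [YoungDiagram.mem_cells, YoungDiagram.mem_iff_lt_rowLen] at hx
    have := h r
    rw [Finset.mem_range]
    dsimp only
    omega
  rw [YoungDiagram.card, Finset.card_eq_sum_card_fiberwise this]
  refine Finset.sum_congr rfl fun c _ => ?_
  rw [YoungDiagram.colLen_eq_card]
  rfl

lemma IsShape.card_eq {g : Fin (k + 1) → ℤ} (hg : IsWindow g) {lam : YoungDiagram}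
    (h : IsShape g lam) :
    lam.card = ∑ x : Fin (k + 1) × Fin (k + 1), ((g x.1 - g x.2) / (k + 1)).toNat := by
  rw [card_eq_sum_colLen h.isKBounded, Fintype.sum_prod_type_right]
  exact Finset.sum_congr rfl fun c _ => h.colLen_eq hg c

/-- The floor changes only when a multiple of k+1 is reached; incongruence of the entries will
exclude this. -/
lemma add_one_ediv_of_not_dvd {x : ℤ} (h : ¬ (k + 1 : ℤ) ∣ x + 1) :
    (x + 1) / (k + 1) = x / (k + 1) := by
  have h0 := Int.emod_nonneg x (show (k + 1 : ℤ) ≠ 0 by omega)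
  have h1 := Int.emod_lt_of_pos x (show (0 : ℤ) < k + 1 by omega)
  have h2 := Int.emod_add_mul_ediv x (k + 1)
  have h3 : x % (k + 1) + 1 ≠ k + 1 := fun he => h ⟨x / (k + 1) + 1, by linarith⟩
  exact ((Int.ediv_emod_unique (show (0 : ℤ) < k + 1 by omega)).mpr
    ⟨show x % (k + 1) + 1 + (k + 1) * (x / (k + 1)) = x + 1 by linarith,
      by omega, by omega⟩).1

/-- Applying an affine transposition changes the size of the partition by one. -/
lemma card_affSwap [NeZero k] {g : Fin (k + 1) → ℤ} {c : ℤ} (hg : IsWindow g)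
    (hg' : IsWindow fun i => affSwap k c (g i)) {lam lam' : YoungDiagram}
    (h : IsShape g lam) (h' : IsShape (fun i => affSwap k c (g i)) lam') :
    lam.card + 1 = lam'.card ∨ lam'.card + 1 = lam.card := by
  have hk : 0 < k := Nat.pos_of_ne_zero (NeZero.ne k)
  obtain ⟨a, ha⟩ := hg.residue.exists_dvd (c - 1)
  obtain ⟨b, hb⟩ := hg.residue.exists_dvd c
  have ha' : (k + 1 : ℤ) ∣ g a + 1 - c := by rwa [show g a + 1 - c = g a - (c - 1) by ring]
  have hab : (k + 1 : ℤ) ∣ g b - g a - 1 := by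
    rw [show g b - g a - 1 = (g b - c) - (g a + 1 - c) by ring]
    exact dvd_sub hb ha'
  have ea : affSwap k c (g a) = g a + 1 := affSwap_of_dvd_succ ha'
  have eb : affSwap k c (g b) = g b - 1 := affSwap_of_dvd hb
  have hne : a ≠ b := by
    rintro rfl
    exact not_dvd_both ha' hb
  have eo : ∀ i, i ≠ a → i ≠ b → affSwap k c (g i) = g i := by
    intro i hia hib
    apply affSwap_of_not
    · intro hd
      apply hia
      apply hg.residue
      rw [show g i - g a = (g i + 1 - c) - (g a + 1 - c) by ring]
      exact dvd_sub hd ha'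
    · intro hd
      apply hib
      apply hg.residue
      rw [show g i - g b = (g i - c) - (g b - c) by ring]
      exact dvd_sub hd hb
  -- Now g b = g a + 1 + (k+1)q. The case q = 0 would exchange two neighbouring entries and destroy
  -- the monotonicity of the new window.
  obtain ⟨q, hq⟩ := hab
  have hq0 : q ≠ 0 := by
    rintro rfl
    have h1 : g a < g b := by linarith
    have h2 := hg'.strictMono (hg.strictMono.lt_iff_lt.mp h1)
    simp only [ea, eb] at h2
    omega
  have hother : ∀ x : Fin (k + 1) × Fin (k + 1), x ≠ (a, b) → x ≠ (b, a) →
      (affSwap k c (g x.1) - affSwap k c (g x.2)) / (k + 1) = (g x.1 - g x.2) / (k + 1) := by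
    rintro ⟨i, j⟩ h1 h2
    simp only
    by_cases hij : i = j
    · subst hij
      simp
    have hnd : ∀ i j, i ≠ j → ¬ (k + 1 : ℤ) ∣ g i - g j := fun i j hij hd =>
      hij (hg.residue _ _ hd)
    by_cases hia : i = a
    · subst hia
      have hjb : j ≠ b := by rintro rfl; exact h1 rfl
      rw [ea, eo j (Ne.symm hij) hjb, show g i + 1 - g j = g i - g j + 1 by ring]
      apply add_one_ediv_of_not_dvd
      intro hd
      apply hnd b j hjb.symm
      rw [show g b - g j = (g i - g j + 1) + (g b - g i - 1) by ring]
      exact dvd_add hd ⟨q, hq⟩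
    by_cases hib : i = b
    · subst hib
      have hja : j ≠ a := by rintro rfl; exact h2 rfl
      rw [eb, eo j hja (Ne.symm hij), show g i - g j = g i - 1 - g j + 1 by ring]
      symm
      apply add_one_ediv_of_not_dvd
      rw [show g i - 1 - g j + 1 = g i - g j by ring]
      exact hnd i j hij
    rw [eo i hia hib]
    by_cases hja : j = a
    · subst hja
      rw [ea, show g i - g j = g i - (g j + 1) + 1 by ring]
      symm
      apply add_one_ediv_of_not_dvd
      rw [show g i - (g j + 1) + 1 = g i - g j by ring]
      exact hnd i j hij
    by_cases hjb : j = b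
    · subst hjb
      rw [eb, show g i - (g j - 1) = g i - g j + 1 by ring]
      apply add_one_ediv_of_not_dvd
      intro hd
      apply hnd i a hia
      rw [show g i - g a = (g i - g j + 1) + (g j - g a - 1) by ring]
      exact dvd_add hd ⟨q, hq⟩
    rw [eo j hja hjb]
  have hdiv : ∀ (r t : ℤ), 0 ≤ r → r < k + 1 → (r + (k + 1) * t) / (k + 1) = t := by
    intro r t h0 h1
    rw [Int.add_mul_ediv_left _ _ (by omega), Int.ediv_eq_zero_of_lt h0 h1, zero_add]
  have d1 : (g b - g a) / (k + 1) = q := by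
    rw [show g b - g a = 1 + (k + 1) * q by linarith]
    exact hdiv _ _ (by omega) (by omega)
  have d2 : (g a - g b) / (k + 1) = -q - 1 := by
    rw [show g a - g b = k + (k + 1) * (-q - 1) by linarith]
    exact hdiv _ _ (by omega) (by omega)
  have d3 : (affSwap k c (g b) - affSwap k c (g a)) / (k + 1) = q - 1 := by
    rw [ea, eb, show g b - 1 - (g a + 1) = k + (k + 1) * (q - 1) by linarith]
    exact hdiv _ _ (by omega) (by omega)
  have d4 : (affSwap k c (g a) - affSwap k c (g b)) / (k + 1) = -q := by
    rw [ea, eb, show g a + 1 - (g b - 1) = 1 + (k + 1) * (-q) by linarith]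
    exact hdiv _ _ (by omega) (by omega)
  rw [h.card_eq hg, h'.card_eq hg']
  have hm : (b, a) ∈ Finset.univ.erase (a, b) :=
    Finset.mem_erase.mpr ⟨fun he => hne (Prod.mk.inj he).2, Finset.mem_univ _⟩
  rw [← Finset.add_sum_erase Finset.univ _ (Finset.mem_univ (a, b)),
    ← Finset.add_sum_erase (Finset.univ.erase (a, b)) _ hm,
    ← Finset.add_sum_erase Finset.univ
      (fun x => ((affSwap k c (g x.1) - affSwap k c (g x.2)) / (k + 1 : ℤ)).toNat)
      (Finset.mem_univ (a, b)),
    ← Finset.add_sum_erase (Finset.univ.erase (a, b))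
      (fun x => ((affSwap k c (g x.1) - affSwap k c (g x.2)) / (k + 1 : ℤ)).toNat) hm]
  have hsum : ∑ x ∈ (Finset.univ.erase (a, b)).erase (b, a),
      ((affSwap k c (g x.1) - affSwap k c (g x.2)) / (k + 1 : ℤ)).toNat =
      ∑ x ∈ (Finset.univ.erase (a, b)).erase (b, a), ((g x.1 - g x.2) / (k + 1)).toNat := by
    refine Finset.sum_congr rfl fun x hx => ?_
    simp only [Finset.mem_erase] at hx
    rw [hother x hx.2.1 hx.1]
  -- Only the pairs (b,a) and (a,b) matter: their floors q and -q-1 become q-1 and -q. The sum of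
  -- the positive parts drops by one if q > 0 and grows by one if q < 0.
  rw [hsum, d1, d2, d3, d4]
  omega

end

end KBounded

namespace KBounded

/-! ### Membership in `Y k m` in terms of windows -/

lemma exists_lt_getElem_iff_lt_countP (c r : ℕ) (l : List ℕ) (hl : l.Pairwise (· ≥ ·)) :
    (∃ h : r < l.length, c < l[r]) ↔ r < l.countP (fun a => c < a) := by
  induction l generalizing r with
  | nil => simp
  | cons a l ih =>
    rw [List.pairwise_cons] at hl
    by_cases hca : c < a
    · rw [List.countP_cons_of_pos (by simpa using hca)]
      cases r with
      | zero => simp [hca]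
      | succ r =>
        rw [Nat.add_lt_add_iff_right, ← ih r hl.2]
        simp
    · have h0 : (a :: l).countP (fun a => c < a) = 0 := by
        rw [List.countP_eq_zero]
        intro b hb
        rcases List.mem_cons.mp hb with rfl | hb
        · simpa using hca
        · have := hl.1 b hb
          simp only [decide_eq_true_eq]
          omega
      rw [h0]
      refine iff_of_false ?_ (by omega)
      rintro ⟨h, hc⟩
      rw [List.countP_eq_zero] at h0
      exact h0 _ (List.getElem_mem h) (by simpa using hc)

lemma colLen_ofParts (s : Multiset ℕ) (c : ℕ) :
    (ofParts s).colLen c = s.countP (fun a => c < a) := by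
  refine eq_of_forall_lt_iff fun r => ?_
  rw [← YoungDiagram.mem_iff_lt_colLen, ofParts, YoungDiagram.mem_ofRowLens]
  have h := exists_lt_getElem_iff_lt_countP c r (s.sort (· ≥ ·))
    (Multiset.pairwise_sort s (· ≥ ·))
  rw [← Multiset.coe_countP, Multiset.sort_eq] at h
  exact h

lemma le_iff_colLen_le {mu nu : YoungDiagram} :
    mu ≤ nu ↔ ∀ c, mu.colLen c ≤ nu.colLen c := by
  constructor
  · intro h c
    refine le_of_forall_lt fun r hr => ?_
    rw [← YoungDiagram.mem_iff_lt_colLen] at hr ⊢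
    exact h hr
  · rintro h ⟨r, c⟩ hx
    rw [YoungDiagram.mem_iff_lt_colLen] at hx ⊢
    exact hx.trans_le (h c)

section

variable {k : ℕ}

/-- A rectangle of width i > c adds k+1-i cells to column c. This number is written as the count of
the a ≤ k with i ≤ a, to match the summation index of `IsShape.colLen_eq`. -/
lemma colLen_ofParts_sum {M : ℕ} (i : Fin M → ℕ) (hi : ∀ j, i j ≤ k) (c : ℕ) :
    (ofParts (∑ j, rectParts k (i j))).colLen c =
      ∑ a : Fin (k + 1), (Finset.univ.filter fun t => c < i t ∧ i t ≤ a).card := by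
  rw [colLen_ofParts]
  have h1 : Multiset.countP (fun a => c < a) (∑ j, rectParts k (i j)) =
      ∑ j, Multiset.countP (fun a => c < a) (rectParts k (i j)) :=
    map_sum (Multiset.countPAddMonoidHom fun a => c < a) _ _
  rw [h1]
  simp only [Finset.card_filter]
  rw [Finset.sum_comm]
  refine Finset.sum_congr rfl fun t _ => ?_
  rw [rectParts, ← Multiset.coe_replicate, Multiset.coe_countP, List.countP_replicate]
  simp only [decide_eq_true_eq]
  split_ifs with hc
  · have h2 := Fin.card_Ici (⟨i t, by have := hi t; omega⟩ : Fin (k + 1))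
    rw [← h2, ← Finset.card_filter]
    congr 1
    ext a
    simp only [Finset.mem_Ici, Finset.mem_filter, Finset.mem_univ, true_and, hc, Fin.le_def]
  · simp [hc]

/-- Downward induction on j. Let N_j count the rectangles wider than j. If the bound fails at j but
holds at every a > j, then splitting the floor at a, which loses at most 1, gives ⌊(g a - g
j)/(k+1)⌋ ≥ N_j - N_a. That is the summand on the rectangle side, and at a = k the inequality is
strict, contradicting the hypothesis for the column j. -/
lemma le_of_sum_le {g : Fin (k + 1) → ℤ} {M : ℕ} (i : Fin M → ℕ)
    (h : ∀ c : Fin (k + 1), ∑ a, ((g a - g c) / (k + 1)).toNat ≤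
      ∑ a : Fin (k + 1), (Finset.univ.filter fun t => (c : ℕ) < i t ∧ i t ≤ a).card)
    (j : Fin (k + 1)) :
    (g (Fin.last k) - g j) / (k + 1) ≤ (Finset.univ.filter fun t => (j : ℕ) < i t).card := by
  induction hN : k - (j : ℕ) using Nat.strong_induction_on generalizing j with
  | _ N ih =>
  by_contra! hcon
  have hj : (j : ℕ) < k := by
    by_contra hj
    obtain rfl : j = Fin.last k := Fin.ext (by simp only [Fin.val_last]; omega)
    simp only [sub_self, Int.zero_ediv] at hcon
    omega
  have hsplit : ∀ a : Fin (k + 1), j ≤ a →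
      (Finset.univ.filter fun t => (j : ℕ) < i t ∧ i t ≤ a).card +
        (Finset.univ.filter fun t => (a : ℕ) < i t).card =
      (Finset.univ.filter fun t => (j : ℕ) < i t).card := by
    intro a hja
    rw [← Finset.card_filter_add_card_filter_not
      (s := Finset.univ.filter fun t => (j : ℕ) < i t) (fun t => i t ≤ a), Finset.filter_filter,
      Finset.filter_filter]
    congr 2
    ext t
    have : (j : ℕ) ≤ a := hja
    simp only [Finset.mem_filter, Finset.mem_univ, true_and]
    omega
  have hlt : ∑ a : Fin (k + 1), (Finset.univ.filter fun t => (j : ℕ) < i t ∧ i t ≤ a).card <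
      ∑ a, ((g a - g j) / (k + 1)).toNat := by
    refine Finset.sum_lt_sum (fun a _ => ?_) ⟨Fin.last k, Finset.mem_univ _, ?_⟩
    · rcases le_or_gt a j with haj | haj
      · have : (Finset.univ.filter fun t => (j : ℕ) < i t ∧ i t ≤ a) = ∅ := by
          refine Finset.filter_eq_empty_iff.mpr fun t _ => ?_
          have : (a : ℕ) ≤ j := haj
          omega
        rw [this]
        exact Nat.zero_le _
      · have h1 := hsplit a haj.le
        have hja : (j : ℕ) < a := haj
        have h2 := ih _ (by omega) a rfl
        have h3 : (g (Fin.last k) - g j) / (k + 1) - (g (Fin.last k) - g a) / (k + 1) - 1 ≤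
            (g a - g j) / (k + 1) := by
          rw [Int.le_ediv_iff_mul_le (by omega)]
          have e1 := Int.ediv_mul_le (g (Fin.last k) - g j) (show (k + 1 : ℤ) ≠ 0 by omega)
          have e2 := Int.lt_ediv_add_one_mul_self (g (Fin.last k) - g a)
            (show (0 : ℤ) < k + 1 by omega)
          linarith
        omega
    · have h1 := hsplit (Fin.last k) (Fin.le_last j)
      omega
  exact absurd (h j) (not_le.mpr hlt)

lemma exists_rects [NeZero k] {g : Fin (k + 1) → ℤ} (hg : Monotone g) {M : ℕ}
    (hM : (g (Fin.last k) - g 0) / (k + 1) ≤ M) :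
    ∃ i : Fin M → ℕ, (∀ t, 1 ≤ i t ∧ i t ≤ k) ∧ ∀ c a : Fin (k + 1),
      ((g a - g c) / (k + 1)).toNat ≤
        (Finset.univ.filter fun t => (c : ℕ) < i t ∧ i t ≤ a).card := by
  have hk : 0 < k := Nat.pos_of_ne_zero (NeZero.ne k)
  have hn : (0 : ℤ) < k + 1 := by omega
  let P : Fin (k + 1) → ℤ := fun a => (g a - g 0) / (k + 1)
  have hPm : Monotone P := fun a b hab =>
    Int.ediv_le_ediv hn (by have := hg hab; omega)
  have hP0 : P 0 = 0 := by simp [P]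
  have hcount : ∀ (t : ℤ) (a : Fin (k + 1)),
      (a : ℕ) < (Finset.univ.filter fun b => P b < t + 1).card ↔ P a < t + 1 :=
    fun t a => lt_card_filter_iff hPm _ _
  -- With P a = ⌊(g a - g 0)/(k+1)⌋, the t-th width is the number of b with P b ≤ t. For c < a, c <
  -- i_t ≤ a then means P c ≤ t < P a, which gives P a - P c rectangles, at least ⌊(g a - g
  -- c)/(k+1)⌋ by superadditivity of the floor. The cap at k only affects those t with P k ≤ t,
  -- which are not needed.
  refine ⟨fun t => min k (Finset.univ.filter fun b => P b < (t : ℕ) + 1).card, ?_, ?_⟩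
  · intro t
    have := (hcount (t : ℕ) 0).mpr (by rw [hP0]; omega)
    exact ⟨le_min hk this, min_le_left _ _⟩
  · intro c a
    rcases le_or_gt a c with hac | hca
    · have h1 := hg hac
      have : (g a - g c) / (k + 1) ≤ 0 := by
        simpa using Int.ediv_le_ediv hn (show g a - g c ≤ 0 by omega)
      omega
    · have hca' : (c : ℕ) < a := hca
      have hPc : 0 ≤ P c := hP0 ▸ hPm (Fin.zero_le c)
      have hPa : P a ≤ M := (hPm (Fin.le_last a)).trans hM
      have hsuper : (g a - g c) / (k + 1) + P c ≤ P a := by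
        simp only [P]
        rw [Int.le_ediv_iff_mul_le hn]
        have e1 := Int.ediv_mul_le (g a - g c) hn.ne'
        have e2 := Int.ediv_mul_le (g c - g 0) hn.ne'
        linarith
      have hbound : ∀ u ∈ Finset.range ((g a - g c) / (k + 1)).toNat,
          (P c).toNat + u < M ∧ (P c + u < P a) := by
        intro u hu
        rw [Finset.mem_range] at hu
        omega
      rw [← Finset.card_range ((g a - g c) / (k + 1)).toNat]
      refine Finset.card_le_card_of_surjOn (fun t => (t : ℕ) - (P c).toNat) ?_
      intro u hu
      obtain ⟨h1, h2⟩ := hbound u hu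
      refine ⟨⟨(P c).toNat + u, h1⟩, ?_, by simp⟩
      simp only [Finset.coe_filter, Finset.mem_univ, true_and, Set.mem_ofPred_eq]
      have e1 := (hcount ((P c).toNat + u : ℕ) c).mpr (by omega)
      have e2 := (hcount ((P c).toNat + u : ℕ) a).not.mpr (by omega)
      omega

/-- Only the spread of the window matters: at column 0, `le_of_sum_le` bounds its floor by the
number m-1 of rectangles, and `exists_rects` shows that this bound is enough for all columns. -/
lemma IsShape.mem_Y_iff [NeZero k] {g : Fin (k + 1) → ℤ} (hg : IsWindow g) {lam : YoungDiagram}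
    (h : IsShape g lam) {m : ℕ} (hm : 0 < m) :
    lam ∈ Y k m ↔ g (Fin.last k) < g 0 + (k + 1) * m := by
  have hn : (0 : ℤ) < k + 1 := by omega
  have hdiv : g (Fin.last k) < g 0 + (k + 1) * m ↔
      (g (Fin.last k) - g 0) / (k + 1) ≤ ((m - 1 : ℕ) : ℤ) := by
    rw [Nat.cast_sub (by omega), Nat.cast_one, Int.le_sub_one_iff, Int.ediv_lt_iff_lt_mul hn]
    constructor <;> intro h <;> linarith
  rw [hdiv]
  constructor
  · rintro ⟨-, i, hi, hle⟩
    have h1 := le_of_sum_le i (fun c => by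
      rw [← h.colLen_eq hg c, ← colLen_ofParts_sum i fun j => (hi j).2]
      exact le_iff_colLen_le.mp hle c) 0
    refine h1.trans ?_
    have := Finset.card_le_univ (Finset.univ.filter fun t => ((0 : Fin (k + 1)) : ℕ) < i t)
    rw [Fintype.card_fin] at this
    exact_mod_cast this
  · intro hM
    obtain ⟨i, hi, hle⟩ := exists_rects hg.strictMono.monotone hM
    refine ⟨h.isKBounded, i, hi, le_iff_colLen_le.mpr fun c => ?_⟩
    rcases Nat.lt_or_ge c (k + 1) with hc | hc
    · rw [colLen_ofParts_sum i (fun j => (hi j).2) c, h.colLen_eq hg ⟨c, hc⟩]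
      exact Finset.sum_le_sum fun a _ => hle ⟨c, hc⟩ a
    · rw [h.colLen_eq_zero (by omega)]
      exact Nat.zero_le _

end

end KBounded

namespace KBounded

/-! ### The rotation of windows -/

section

variable {k : ℕ}

/-- The effect of the rotation of the dilated fundamental alcove on windows. -/
def rotateWindow (m : ℕ) (g : Fin (k + 1) → ℤ) : Fin (k + 1) → ℤ :=
  Fin.cases (g (Fin.last k) - (k + 1) * m + m) (fun i => g i.castSucc + m)

lemma rotateWindow_zero (m : ℕ) (g : Fin (k + 1) → ℤ) :
    rotateWindow m g 0 = g (Fin.last k) - (k + 1) * m + m := rfl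

lemma rotateWindow_succ (m : ℕ) (g : Fin (k + 1) → ℤ) (i : Fin k) :
    rotateWindow m g i.succ = g i.castSucc + m := rfl

/-- The cyclic form of the definition. The correction at the wrap is a multiple of k+1, hence
invisible to residues and compatible with `affSwap`. -/
lemma rotateWindow_add_one (m : ℕ) (g : Fin (k + 1) → ℤ) (i : Fin (k + 1)) :
    rotateWindow m g (i + 1) = g i + m - (k + 1) * (if i = Fin.last k then (m : ℤ) else 0) := by
  induction i using Fin.lastCases with
  | last => rw [Fin.last_add_one, rotateWindow_zero, if_pos rfl]; ring
  | cast i =>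
    rw [Fin.coeSucc_eq_succ, rotateWindow_succ, if_neg (Fin.castSucc_lt_last i).ne]; ring

/-- Monotonicity and the bound on the spread trade places: the old bound puts the new first entry
below the others, and the old last step yields the new bound. Adding m to each of the k+1 entries is
offset by the single subtraction of (k+1)m. -/
lemma IsWindow.rotateWindow [NeZero k] {g : Fin (k + 1) → ℤ} (hg : IsWindow g) {m : ℕ}
    (hm : g (Fin.last k) < g 0 + (k + 1) * m) :
    IsWindow (rotateWindow m g) ∧
      KBounded.rotateWindow m g (Fin.last k) < KBounded.rotateWindow m g 0 + (k + 1) * m := by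
  have hk : 0 < k := Nat.pos_of_ne_zero (NeZero.ne k)
  refine ⟨⟨?_, ?_, ?_⟩, ?_⟩
  · intro i j hij
    induction j using Fin.cases with
    | zero => exact absurd hij (Fin.not_lt_zero i)
    | succ j =>
      rw [rotateWindow_succ]
      induction i using Fin.cases with
      | zero =>
        rw [rotateWindow_zero]
        have := hg.strictMono.monotone (Fin.zero_le j.castSucc)
        linarith
      | succ i =>
        rw [rotateWindow_succ]
        have := hg.strictMono (show i.castSucc < j.castSucc by simpa using hij)
        linarith
  · intro i j hij
    rw [← sub_add_cancel i 1, ← sub_add_cancel j 1, rotateWindow_add_one,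
      rotateWindow_add_one] at hij
    have h1 : (k + 1 : ℤ) ∣ g (i - 1) - g (j - 1) := by
      obtain ⟨t, ht⟩ := hij
      exact ⟨t + (if i - 1 = Fin.last k then (m : ℤ) else 0)
        - (if j - 1 = Fin.last k then (m : ℤ) else 0), by linarith⟩
    exact sub_left_injective (hg.residue _ _ h1)
  · rw [← hg.sum, Fin.sum_univ_succ, Fin.sum_univ_castSucc, rotateWindow_zero]
    simp only [rotateWindow_succ, Finset.sum_add_distrib, Finset.sum_const, Finset.card_univ,
      Fintype.card_fin, nsmul_eq_mul]
    ring
  · obtain ⟨j, hj⟩ : ∃ j : Fin k, j.succ = Fin.last k :=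
      ⟨⟨k - 1, by omega⟩, Fin.ext (by simp only [Fin.val_succ, Fin.val_last]; omega)⟩
    rw [← hj, rotateWindow_succ, rotateWindow_zero]
    have := hg.strictMono (Fin.castSucc_lt_last j)
    linarith

lemma rotateWindow_iterate (m : ℕ) (g : Fin (k + 1) → ℤ) (t : ℕ) (i j : Fin (k + 1)) :
    ((i : ℕ) + t = j → (rotateWindow m)^[t] g j = g i + t * m) ∧
    ((i : ℕ) + t = j + (k + 1) → (rotateWindow m)^[t] g j = g i + t * m - (k + 1) * m) := by
  induction t generalizing j with
  | zero =>
    refine ⟨fun h => ?_, fun h => absurd h (by omega)⟩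
    obtain rfl : i = j := Fin.ext (by omega)
    simp
  | succ t ih =>
    simp only [Function.iterate_succ_apply']
    induction j using Fin.cases with
    | zero =>
      refine ⟨fun h => absurd h (by simp), fun h => ?_⟩
      rw [rotateWindow_zero, (ih (Fin.last k)).1 (by
        simp only [Fin.val_last, Fin.val_zero] at h ⊢; omega)]
      push_cast
      ring
    | succ j =>
      simp only [Fin.val_succ]
      refine ⟨fun h => ?_, fun h => ?_⟩
      · rw [rotateWindow_succ, (ih j.castSucc).1 (by simp only [Fin.val_castSucc]; omega)]
        push_cast
        ring
      · rw [rotateWindow_succ, (ih j.castSucc).2 (by simp only [Fin.val_castSucc]; omega)]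
        push_cast
        ring

lemma rotateWindow_iterate_card (m : ℕ) (g : Fin (k + 1) → ℤ) :
    (rotateWindow m)^[k + 1] g = g := by
  funext j
  rw [(rotateWindow_iterate m g (k + 1) j j).2 rfl]
  push_cast
  ring

lemma rotateWindow_iterate_id_ne {m : ℕ} (hm : 1 < m) {t : ℕ} (ht : 0 < t) (htk : t < k + 1) :
    (rotateWindow m)^[t] (fun i : Fin (k + 1) => ((i : ℕ) : ℤ)) ≠
      fun i : Fin (k + 1) => ((i : ℕ) : ℤ) := by
  intro h
  -- After t steps, position 0 holds the entry that started at k+1-t, with value -(k+1-t)(m-1). This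
  -- is non-zero as m > 1.
  have h1 := (rotateWindow_iterate m (fun i : Fin (k + 1) => ((i : ℕ) : ℤ)) t
    ⟨k + 1 - t, by omega⟩ 0).2 (by simp only [Fin.val_zero]; omega)
  rw [h] at h1
  simp only [Fin.val_zero, Nat.cast_zero] at h1
  rw [Nat.cast_sub htk.le] at h1
  push_cast at h1
  have h2 : ((k : ℤ) + 1 - t) * (m - 1) = 0 := by linarith
  rcases mul_eq_zero.mp h2 with h3 | h3 <;> omega

/-- Translation by m conjugates the transposition at c into the one at c+m, and multiples of k+1
commute with both. The rotation thus permutes the labels of the edges. -/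
lemma rotateWindow_affSwap_iff (m : ℕ) (g g' : Fin (k + 1) → ℤ) :
    (∃ c, ∀ j, rotateWindow m g' j = affSwap k c (rotateWindow m g j)) ↔
      ∃ c, ∀ j, g' j = affSwap k c (g j) := by
  have key : ∀ (c : ℤ) (i : Fin (k + 1)),
      rotateWindow m g' (i + 1) = affSwap k (c + m) (rotateWindow m g (i + 1)) ↔
        g' i = affSwap k c (g i) := by
    intro c i
    rw [rotateWindow_add_one, rotateWindow_add_one]
    generalize (if i = Fin.last k then (m : ℤ) else 0) = e
    rw [show g i + m - (k + 1) * e = g i + (k + 1) * (-e) + m by ring, affSwap_add,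
      affSwap_add_mul]
    constructor <;> intro h <;> linarith
  constructor
  · rintro ⟨c, h⟩
    refine ⟨c - m, fun j => (key _ j).mp ?_⟩
    rw [sub_add_cancel]
    exact h _
  · rintro ⟨c, h⟩
    refine ⟨c + m, fun j => ?_⟩
    rw [← sub_add_cancel j 1]
    exact (key c _).mpr (h _)

/-! ### The rotation of the dilated fundamental alcove -/

/-- The linear part of the rotation. -/
def rotationLinear (k : ℕ) : V k →ₗ[ℝ] V k where
  toFun x j := rootCoeff x j - rootCoeff x k
  map_add' x y := by
    have h : ∀ a, rootCoeff (x + y) a = rootCoeff x a + rootCoeff y a := by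
      intro a
      have := rootCoeff_sub_smul x y (-1) a
      rwa [neg_smul, one_smul, sub_neg_eq_add, neg_mul, one_mul, sub_neg_eq_add] at this
    funext j
    simp only [h, Pi.add_apply]
    ring
  map_smul' t x := by
    have h : ∀ a, rootCoeff (t • x) a = t * rootCoeff x a := by
      intro a
      cases a with
      | zero => simp [rootCoeff]
      | succ a =>
        simp only [rootCoeff]
        split_ifs <;> simp
    funext j
    simp only [h, Pi.smul_apply, smul_eq_mul, RingHom.id_apply]
    ring

/-- The rotation of the `m`-fold dilation of the fundamental alcove, as an affine map. -/
noncomputable def rotationMap (k m : ℕ) : V k →ᵃ[ℝ] V k :=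
  (rotationLinear k).toAffineMap +
    -- The coefficients of m times the first fundamental weight, the image of the vertex 0.
    AffineMap.const ℝ (V k) (fun j : Fin k => (m : ℝ) * (1 - ((j : ℕ) + 1) / (k + 1)))

lemma rootCoeff_rotationMap (m : ℕ) (x : V k) {a : ℕ} (ha : a ≤ k) :
    rootCoeff (rotationMap k m x) (a + 1) =
      rootCoeff x a - rootCoeff x k + m * (1 - ((a : ℝ) + 1) / (k + 1)) := by
  rcases Nat.lt_or_ge a k with h | h
  · simp only [rootCoeff, dif_pos h]
    rfl
  · obtain rfl : a = k := by omega
    have : (a : ℝ) + 1 ≠ 0 := by positivity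
    rw [rootCoeff_last, div_self this]
    ring

/-- In sum-zero coordinates the rotation is a cyclic shift followed by a translation; the term m at
the wrap balances the k+1 terms -m/(k+1). It is the geometric counterpart of `rotateWindow_add_one`.
-/
lemma coord_rotationMap (m : ℕ) (x : V k) (i : Fin (k + 1)) :
    coord (rotationMap k m x) ((i + 1 : Fin (k + 1)) : ℕ) =
      coord x i - m / (k + 1) + (if i = Fin.last k then (m : ℝ) else 0) := by
  have hk : (k : ℝ) + 1 ≠ 0 := by positivity
  induction i using Fin.lastCases with
  | last =>
    rw [Fin.last_add_one, if_pos rfl]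
    unfold coord
    rw [Fin.val_zero, Fin.val_last, rootCoeff_rotationMap m x (Nat.zero_le k), rootCoeff_last]
    simp only [rootCoeff]
    push_cast
    field_simp
    ring
  | cast i =>
    rw [Fin.coeSucc_eq_succ, if_neg (Fin.castSucc_lt_last i).ne]
    unfold coord
    rw [Fin.val_succ, Fin.val_castSucc, rootCoeff_rotationMap m x (by omega),
      rootCoeff_rotationMap m x (by omega)]
    push_cast
    field_simp
    ring

lemma rotationMap_bijective (k m : ℕ) : Function.Bijective (rotationMap k m) := by
  constructor
  · intro x y hxy
    refine coord_injective fun i => ?_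
    have h1 := coord_rotationMap m x i
    rw [hxy, coord_rotationMap] at h1
    linarith
  · intro y
    have hk : (k : ℝ) + 1 ≠ 0 := by positivity
    obtain ⟨x, hx⟩ := exists_coord_eq (k := k)
      (X := fun i => coord y ((i + 1 : Fin (k + 1)) : ℕ) + m / (k + 1)
        - (if i = Fin.last k then (m : ℝ) else 0)) (by
        have h0 : ∑ i : Fin (k + 1), coord y ((i + 1 : Fin (k + 1)) : ℕ) = 0 :=
          (Equiv.sum_comp (Equiv.addRight (1 : Fin (k + 1))) (fun i => coord y (i : ℕ))).trans
            (sum_coord y)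
        rw [Finset.sum_sub_distrib, Finset.sum_add_distrib, h0]
        simp only [Finset.sum_const, Finset.card_univ, Fintype.card_fin, nsmul_eq_mul,
          Finset.sum_ite_eq', Finset.mem_univ, if_true]
        push_cast
        field_simp
        ring)
    refine ⟨x, coord_injective fun i => ?_⟩
    have h1 := coord_rotationMap m x (i - 1)
    rw [hx, sub_add_cancel] at h1
    rw [h1]
    ring

/-- The rotation of the `m`-fold dilation of the fundamental alcove. -/
noncomputable def rotation (k m : ℕ) : V k ≃ᵃ[ℝ] V k :=
  AffineEquiv.ofBijective (rotationMap_bijective k m)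

lemma coord_rotation (m : ℕ) (x : V k) (i : Fin (k + 1)) :
    coord (rotation k m x) ((i + 1 : Fin (k + 1)) : ℕ) =
      coord x i - m / (k + 1) + (if i = Fin.last k then (m : ℝ) else 0) :=
  coord_rotationMap m x i

lemma coord_dilatedVertex (m : ℕ) (i r : Fin (k + 1)) :
    coord (dilatedVertex k m i) r =
      m * ((if r < i then 1 else 0) - ((i : ℕ) : ℝ) / (k + 1)) := by
  have hk : (k : ℝ) + 1 ≠ 0 := by positivity
  induction i using Fin.cases with
  | zero =>
    rw [show dilatedVertex k m 0 = 0 from rfl, if_neg (Fin.not_lt_zero r)]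
    have : ∀ a, rootCoeff (0 : V k) a = 0 := by
      intro a
      cases a <;> simp [rootCoeff]
    simp [coord, this]
  | succ i =>
    rw [show dilatedVertex k m i.succ = (m : ℝ) • fundamentalWeight i from rfl]
    have hi : ((i : ℕ) : ℝ) + 1 ≤ k := by exact_mod_cast i.isLt
    have hc : ∀ a : ℕ, a ≤ k + 1 → rootCoeff ((m : ℝ) • fundamentalWeight i) a =
        m * (min ((i : ℝ) + 1) a - ((i : ℝ) + 1) * a / (k + 1)) := by
      intro a ha
      cases a with
      | zero =>
        have : (0 : ℝ) ≤ (i : ℕ) + 1 := by positivity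
        simp [rootCoeff, this]
      | succ a =>
        rcases Nat.lt_or_ge a k with h | h
        · simp only [rootCoeff, dif_pos h]
          simp [fundamentalWeight]
        · obtain rfl : a = k := by omega
          rw [rootCoeff_last]
          push_cast
          rw [min_eq_left (by linarith), mul_div_assoc, div_self hk]
          ring
    unfold coord
    rw [hc _ (by omega), hc _ (by omega), Fin.val_succ]
    split_ifs with h
    · have h' : (r : ℕ) + 1 ≤ (i : ℕ) + 1 := by
        have : (r : ℕ) < i.succ := h
        rw [Fin.val_succ] at this
        omega
      have h'' : ((r : ℕ) : ℝ) + 1 ≤ (i : ℕ) + 1 := by exact_mod_cast h'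
      push_cast
      rw [min_eq_right h'', min_eq_right (by linarith)]
      field_simp
      ring
    · have h' : (i : ℕ) + 1 ≤ r := by
        have : ¬ (r : ℕ) < i.succ := h
        rw [Fin.val_succ] at this
        omega
      have h'' : ((i : ℕ) : ℝ) + 1 ≤ (r : ℕ) := by exact_mod_cast h'
      push_cast
      rw [min_eq_left (by linarith), min_eq_left h'']
      field_simp
      ring

lemma rotation_dilatedVertex (m : ℕ) (i : Fin (k + 1)) :
    rotation k m (dilatedVertex k m i) = dilatedVertex k m (i + 1) := by
  have hk : (k : ℝ) + 1 ≠ 0 := by positivity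
  refine coord_injective fun r => ?_
  obtain ⟨r, rfl⟩ : ∃ s, r = s + 1 := ⟨r - 1, (sub_add_cancel r 1).symm⟩
  rw [coord_rotation, coord_dilatedVertex, coord_dilatedVertex]
  induction i using Fin.lastCases with
  | last =>
    rw [Fin.last_add_one, if_neg (Fin.not_lt_zero _)]
    induction r using Fin.lastCases with
    | last =>
      simp only [lt_irrefl, if_false, if_true, Fin.val_last, Fin.val_zero]
      push_cast
      field_simp
      ring
    | cast r =>
      rw [if_pos (Fin.castSucc_lt_last r), if_neg (Fin.castSucc_lt_last r).ne]
      simp only [Fin.val_last, Fin.val_zero]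
      push_cast
      field_simp
      ring
  | cast i =>
    rw [Fin.coeSucc_eq_succ]
    induction r using Fin.lastCases with
    | last =>
      rw [Fin.last_add_one, if_neg (not_lt.mpr (Fin.le_last _)), if_pos rfl,
        if_pos (Fin.succ_pos i)]
      simp only [Fin.val_succ, Fin.val_castSucc]
      push_cast
      field_simp
      ring
    | cast r =>
      rw [Fin.coeSucc_eq_succ, if_neg (Fin.castSucc_lt_last r).ne]
      simp only [Fin.castSucc_lt_castSucc_iff, Fin.succ_lt_succ_iff, Fin.val_succ,
        Fin.val_castSucc]
      push_cast
      field_simp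
      ring

/-- In differences the common translations cancel. What is left at the wrap, m for coordinates and
-(k+1)m for entries, is on both sides a shift of the period `t` by m. -/
lemma rotation_image_windowAlcove (m : ℕ) (g : Fin (k + 1) → ℤ) :
    rotation k m '' windowAlcove g = windowAlcove (rotateWindow m g) := by
  have key : ∀ x, rotation k m x ∈ windowAlcove (rotateWindow m g) ↔ x ∈ windowAlcove g := by
    intro x
    constructor
    · intro h i j t hij
      have h1 := h (i + 1) (j + 1) (t + (if j = Fin.last k then (m : ℤ) else 0)
        - (if i = Fin.last k then (m : ℤ) else 0)) (by
        rw [rotateWindow_add_one, rotateWindow_add_one]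
        linarith)
      rw [coord_rotation, coord_rotation] at h1
      push_cast at h1
      linarith
    · intro h i j t hij
      obtain ⟨i, rfl⟩ : ∃ s, i = s + 1 := ⟨i - 1, (sub_add_cancel i 1).symm⟩
      obtain ⟨j, rfl⟩ : ∃ s, j = s + 1 := ⟨j - 1, (sub_add_cancel j 1).symm⟩
      rw [rotateWindow_add_one, rotateWindow_add_one] at hij
      rw [coord_rotation, coord_rotation]
      have h1 := h i j (t + (if i = Fin.last k then (m : ℤ) else 0)
        - (if j = Fin.last k then (m : ℤ) else 0)) (by linarith)
      push_cast at h1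
      linarith
  ext y
  obtain ⟨x, rfl⟩ := (rotation k m).surjective y
  rw [key, (rotation k m).injective.mem_set_image]

/-! ### The Hasse diagram and Suter's symmetry -/

lemma windowBeads_eq_of_range_eq {g g' : Fin (k + 1) → ℤ} (h : Set.range g = Set.range g') :
    windowBeads g = windowBeads g' := by
  have key : ∀ f : Fin (k + 1) → ℤ,
      windowBeads f = {b | ∃ a ∈ Set.range f, (k + 1 : ℤ) ∣ a - b ∧ b < a} := by
    intro f
    ext b
    simp [windowBeads]
  rw [key, key, h]

/-- If the generator did not send the window to a window, it would exchange two of its entries and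
fix the core, which the change of size excludes. -/
lemma KCovers.exists_affSwap [NeZero k] {g g' : Fin (k + 1) → ℤ} (hg : IsWindow g)
    (hg' : IsWindow g') {lam lam' : YoungDiagram} (h : IsShape g lam) (h' : IsShape g' lam')
    (hc : KCovers k lam lam') : ∃ c, ∀ j, g' j = affSwap k c (g j) := by
  obtain ⟨hcard, mu, nu, hmu, hnu, i, hi⟩ := hc
  have hne : g ≠ g' := by
    rintro rfl
    rw [h.unique h'] at hcard
    omega
  obtain ⟨mu', e1, e2⟩ := h
  obtain ⟨nu', e3, e4⟩ := h'
  obtain rfl := hmu.core_unique e2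
  obtain rfl := hnu.core_unique e4
  have e5 := beadSet_eq_of_coreAct hmu.beadClosed e1 i
  rw [hi, e3] at e5
  rcases hg.map_affSwap_or ((i : ℕ) : ℤ) with hw | hr
  · exact ⟨_, fun j => congrFun (hg'.eq_of_windowBeads_eq hw e5) j⟩
  · rw [windowBeads_eq_of_range_eq hr] at e5
    exact absurd (hg.eq_of_windowBeads_eq hg' e5.symm) hne

lemma hasseAdj_iff [NeZero k] {g g' : Fin (k + 1) → ℤ} (hg : IsWindow g) (hg' : IsWindow g')
    {lam lam' : YoungDiagram} (h : IsShape g lam) (h' : IsShape g' lam') :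
    HasseAdj k lam lam' ↔ ∃ c, ∀ j, g' j = affSwap k c (g j) := by
  constructor
  · rintro (hc | hc)
    · exact hc.exists_affSwap hg hg' h h'
    · obtain ⟨c, hc⟩ := hc.exists_affSwap hg' hg h' h
      exact ⟨c, fun j => by rw [hc j, affSwap_involutive]⟩
  · rintro ⟨c, hc⟩
    obtain rfl : g' = fun j => affSwap k c (g j) := funext hc
    have hcard := card_affSwap hg hg' h h'
    obtain ⟨mu, e1, e2⟩ := h
    obtain ⟨nu, e3, e4⟩ := h'
    obtain ⟨i, hi⟩ := exists_fin_affSwap (k := k) c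
    have hact : coreAct i mu = nu := by
      apply eq_of_beadSet_eq
      rw [beadSet_eq_of_coreAct e2.beadClosed e1 i, e3, hi]
    rcases hcard with hcard | hcard
    · exact Or.inl ⟨hcard, mu, nu, e2, e4, i, hact⟩
    · exact Or.inr ⟨hcard, nu, mu, e4, e2, i, by rw [← hact, coreAct_coreAct i e2.beadClosed]⟩

/-- For m = 2 entries differ by less than 2(k+1), so each positive floor is 1 and the columns merely
count entries. The rule is checked column by column. -/
lemma suter_rowLen [NeZero k] {g : Fin (k + 1) → ℤ} (hg : IsWindow g)
    (hm : g (Fin.last k) < g 0 + (k + 1) * (2 : ℕ)) {lam lam' : YoungDiagram} (h : IsShape g lam)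
    (h' : IsShape (rotateWindow 2 g) lam') (r : ℕ) :
    lam'.rowLen r = if r < k - lam.rowLen 0 then lam.rowLen (r + 1) + 1 else 0 := by
  have hg' := (hg.rotateWindow hm).1
  have hn : (0 : ℤ) < k + 1 := by omega
  have hdiff : ∀ i j, g i - g j < (k + 1) * 2 := by
    intro i j
    have h1 := hg.strictMono.monotone (Fin.le_last i)
    have h2 := hg.strictMono.monotone (Fin.zero_le j)
    push_cast at hm
    linarith
  have hdiv0 : ∀ x : ℤ, x < k + 1 → (x / (k + 1)).toNat = 0 := by
    intro x hx
    have : x / (k + 1) < 1 := by rw [Int.ediv_lt_iff_lt_mul hn]; omega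
    omega
  have hdiv1 : ∀ x : ℤ, (k + 1 : ℤ) ≤ x → x < (k + 1) * 2 → (x / (k + 1)).toNat = 1 := by
    intro x hx hx'
    have h1 : x / (k + 1) < 2 := by rw [Int.ediv_lt_iff_lt_mul hn]; linarith
    have h2 : 1 ≤ x / (k + 1) := by rw [Int.le_ediv_iff_mul_le hn]; omega
    omega
  -- Rotation drops the contribution of the last entry to column c. It equals 1 unless the column is
  -- empty, so this deletes the first row.
  have hsucc : ∀ c : ℕ, lam'.colLen (c + 1) = lam.colLen c - 1 := by
    intro c
    rcases Nat.lt_or_ge c k with hc | hc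
    · have e1 := h.colLen_eq hg (Fin.castSucc ⟨c, hc⟩)
      have e2 := h'.colLen_eq hg' (Fin.succ ⟨c, hc⟩)
      rw [Fin.sum_univ_succ] at e2
      have e3 := hg'.strictMono (Fin.succ_pos (⟨c, hc⟩ : Fin k))
      simp only [rotateWindow_succ, add_sub_add_right_eq_sub] at e2
      rw [hdiv0 _ (by rw [rotateWindow_succ] at e3; omega), zero_add] at e2
      simp only [Fin.val_castSucc, Fin.val_succ] at e1 e2
      rcases lt_or_ge (g (Fin.last k) - g (Fin.castSucc ⟨c, hc⟩)) (k + 1) with hlt | hge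
      · have e4 : ∀ i, ((g i - g (Fin.castSucc ⟨c, hc⟩)) / (k + 1)).toNat = 0 := by
          intro i
          have := hg.strictMono.monotone (Fin.le_last i)
          exact hdiv0 _ (by omega)
        simp only [e4, Finset.sum_const_zero] at e1 e2
        omega
      · rw [Fin.sum_univ_castSucc, hdiv1 _ hge (hdiff _ _)] at e1
        omega
    · rw [h.colLen_eq_zero hc, h'.colLen_eq_zero (by omega)]
  have hrow : lam.rowLen 0 =
      (Finset.univ.filter fun i => g i < g (Fin.last k) - k).card := by
    refine eq_of_forall_lt_iff fun c => ?_
    rcases Nat.lt_or_ge c (k + 1) with hc | hc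
    · rw [lt_card_filter_iff hg.strictMono.monotone _ (⟨c, hc⟩ : Fin (k + 1)),
        ← lt_colLen_iff_lt_rowLen, h.colLen_eq hg (⟨c, hc⟩ : Fin (k + 1)),
        Finset.sum_pos_iff]
      constructor
      · rintro ⟨i, -, hi⟩
        by_contra hcon
        have := hg.strictMono.monotone (Fin.le_last i)
        rw [hdiv0 _ (by omega)] at hi
        omega
      · intro hlt
        exact ⟨Fin.last k, Finset.mem_univ _, by rw [hdiv1 _ (by omega) (hdiff _ _)]; omega⟩
    · have h1 := h.isKBounded 0
      have h2 := Finset.card_le_univ (Finset.univ.filter fun i => g i < g (Fin.last k) - k)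
      rw [Fintype.card_fin] at h2
      omega
  -- For j < k, the entry j counts towards the new first column if it is within k of the last entry,
  -- and towards the old first row otherwise. Exactly one of these happens.
  have hzero : lam'.colLen 0 + lam.rowLen 0 = k := by
    have e2 := h'.colLen_eq hg' 0
    rw [Fin.sum_univ_succ, sub_self, Int.zero_ediv, Int.toNat_zero, zero_add] at e2
    simp only [Fin.val_zero, rotateWindow_succ, rotateWindow_zero] at e2
    rw [e2, hrow, Finset.card_filter, Fin.sum_univ_castSucc, if_neg (by omega), add_zero,
      ← Finset.sum_add_distrib]
    trans ∑ _j : Fin k, 1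
    · refine Finset.sum_congr rfl fun j _ => ?_
      have hlast := hg.strictMono (Fin.castSucc_lt_last j)
      rw [show g j.castSucc + ((2 : ℕ) : ℤ) - (g (Fin.last k) - (k + 1) * ((2 : ℕ) : ℤ) + (2 : ℕ))
        = (k + 1) * 2 - (g (Fin.last k) - g j.castSucc) by push_cast; ring]
      have hlt := hdiff (Fin.last k) j.castSucc
      have hne : g (Fin.last k) - g j.castSucc ≠ k + 1 := fun he =>
        (Fin.castSucc_lt_last j).ne' (hg.residue _ _ (by rw [he]))
      split_ifs with hj
      · rw [hdiv0 _ (by omega)]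
      · rw [hdiv1 _ (by omega) (by omega)]
    · simp
  refine eq_of_forall_lt_iff fun c => ?_
  rw [← lt_colLen_iff_lt_rowLen]
  have hrk : k - lam.rowLen 0 = lam'.colLen 0 := by omega
  rw [hrk]
  cases c with
  | zero => split_ifs with hr <;> omega
  | succ c =>
    have h1 := lam'.colLen_anti 0 (c + 1) (Nat.zero_le _)
    have h2 := lt_colLen_iff_lt_rowLen lam (r := r + 1) (c := c)
    rw [hsucc] at h1 ⊢
    split_ifs with hr <;> omega

/-- The windows of the alcoves in the `m`-fold dilation of the fundamental alcove. -/
def BoundedWindow (k m : ℕ) : Type :=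
  {g : Fin (k + 1) → ℤ // IsWindow g ∧ g (Fin.last k) < g 0 + (k + 1) * m}

variable [NeZero k]

/-- The rotation as a permutation of the bounded windows. -/
def rotatePerm (k m : ℕ) [NeZero k] : Equiv.Perm (BoundedWindow k m) :=
  let f : BoundedWindow k m → BoundedWindow k m :=
    fun g => ⟨rotateWindow m g.1, g.2.1.rotateWindow g.2.2⟩
  have hf : ∀ t g, (f^[t] g).1 = (rotateWindow m)^[t] g.1 := fun t => by
    induction t with
    | zero => exact fun _ => rfl
    | succ t ih => exact fun g => ih (f g)
  { toFun := f
    invFun := f^[k]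
    left_inv := fun g => Subtype.ext (by
      rw [← Function.iterate_succ_apply, hf, rotateWindow_iterate_card])
    right_inv := fun g => Subtype.ext (by
      rw [← Function.iterate_succ_apply' f, hf, rotateWindow_iterate_card]) }

lemma rotatePerm_apply {m : ℕ} (g : BoundedWindow k m) :
    (rotatePerm k m g).1 = rotateWindow m g.1 := rfl

lemma rotatePerm_pow_apply {m : ℕ} (t : ℕ) (g : BoundedWindow k m) :
    ((rotatePerm k m ^ t) g).1 = (rotateWindow m)^[t] g.1 := by
  induction t generalizing g with
  | zero => rfl
  | succ t ih => rw [pow_succ, Equiv.Perm.mul_apply, ih, rotatePerm_apply]; rfl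

lemma orderOf_rotatePerm {m : ℕ} (hm : 1 < m) : orderOf (rotatePerm k m) = k + 1 := by
  rw [orderOf_eq_iff (by omega)]
  constructor
  · ext1 g
    exact Subtype.ext (by rw [rotatePerm_pow_apply, rotateWindow_iterate_card]; rfl)
  · intro t ht ht0 h
    -- The identity window, that of the empty partition, already has an orbit of full length.
    have hid : ((Fin.last k : Fin (k + 1)) : ℕ) <
        (((0 : Fin (k + 1)) : ℕ) : ℤ) + (k + 1) * (m : ℤ) := by
      have : (k + 1 : ℤ) * 1 < (k + 1) * m := mul_lt_mul_of_pos_left (by omega) (by omega)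
      simp only [Fin.val_last, Fin.val_zero, Nat.cast_zero]
      linarith
    have h1 := rotatePerm_pow_apply (m := m) t ⟨_, isWindow_id (k := k), hid⟩
    rw [h] at h1
    exact rotateWindow_iterate_id_ne hm ht0 ht h1.symm

lemma exists_equiv_Y (k : ℕ) [NeZero k] {m : ℕ} (hm : 0 < m) :
    ∃ E : BoundedWindow k m ≃ Y k m, ∀ g, IsShape g.1 (E g : YoungDiagram) := by
  choose f hf using fun g : BoundedWindow k m => g.2.1.exists_isShape
  refine ⟨Equiv.ofBijective (fun g => ⟨f g, ((hf g).mem_Y_iff g.2.1 hm).mpr g.2.2⟩) ⟨?_, ?_⟩, hf⟩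
  · intro g g' h
    have h1 : f g = f g' := congrArg Subtype.val h
    exact Subtype.ext (IsShape.window_unique g.2.1 g'.2.1 (hf g) (h1 ▸ hf g'))
  · rintro ⟨lam, hlam⟩
    obtain ⟨g, hg, hs⟩ := exists_window_of_isKBounded hlam.1
    exact ⟨⟨g, hg, (hs.mem_Y_iff hg hm).mp hlam⟩, Subtype.ext ((hf _).unique hs)⟩

lemma exists_equiv_dominantAlcoves (k : ℕ) [NeZero k] (m : ℕ) :
    ∃ F : BoundedWindow k m ≃ dominantAlcoves k m,
      ∀ g, (F g : Set (V k)) = windowAlcove g.1 := by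
  refine ⟨Equiv.ofBijective (fun g => ⟨windowAlcove g.1,
    (mem_dominantAlcoves_iff m _).mpr ⟨g.1, g.2.1, g.2.2, rfl⟩⟩) ⟨?_, ?_⟩, fun _ => rfl⟩
  · intro g g' h
    exact Subtype.ext (windowAlcove_injective g.2.1 g'.2.1 (congrArg Subtype.val h))
  · rintro ⟨A, hA⟩
    obtain ⟨g, hg, hgm, rfl⟩ := (mem_dominantAlcoves_iff m A).mp hA
    exact ⟨⟨g, hg, hgm⟩, rfl⟩

end

end KBounded

/-! ### Transport of the rotation from windows to partitions and alcoves -/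

theorem mainTheorem1 (k m : ℕ) (hk : 0 < k) (hm : 1 < m) :
    ∃ (Φ : KBounded.Y k m ≃ KBounded.dominantAlcoves k m)
      (ρ : KBounded.V k ≃ᵃ[ℝ] KBounded.V k)
      (σ : Equiv.Perm (KBounded.Y k m)),
      -- `Φ` is the correspondence between partitions and dominant alcoves
      (∀ (y : KBounded.Y k m) (A : Set (KBounded.V k)),
        KBounded.Corresponds k y A ↔ A = Φ y) ∧
      (∀ (lam : YoungDiagram) (a : KBounded.dominantAlcoves k m),
        KBounded.Corresponds k lam a ↔ lam = Φ.symm a) ∧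
      -- `ρ` rotates the vertices of the `m`-fold dilation of the fundamental alcove
      (∀ i : Fin (k + 1), ρ (KBounded.dilatedVertex k m i) = KBounded.dilatedVertex k m (i + 1)) ∧
      -- `σ` is induced by `ρ` and generates a cyclic action of order `k + 1`
      (∀ y : KBounded.Y k m, (Φ (σ y) : Set (KBounded.V k)) = ρ '' (Φ y : Set (KBounded.V k))) ∧
      orderOf σ = k + 1 ∧
      -- `σ` is a symmetry of the Hasse diagram
      (∀ y z : KBounded.Y k m,
        KBounded.HasseAdj k (σ y) (σ z) ↔ KBounded.HasseAdj k y z) ∧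
      -- for `m = 2` it is Suter's map: delete the first part `y₁`, prepend a column of `k - y₁` cells
      (m = 2 → ∀ (y : KBounded.Y k m) (r : ℕ),
        (σ y : YoungDiagram).rowLen r =
          if r < k - (y : YoungDiagram).rowLen 0
          then (y : YoungDiagram).rowLen (r + 1) + 1 else 0) := by
  have : NeZero k := ⟨hk.ne'⟩
  obtain ⟨E, hE⟩ := KBounded.exists_equiv_Y k (zero_lt_one.trans hm)
  obtain ⟨F, hF⟩ := KBounded.exists_equiv_dominantAlcoves k m
  have hE' : ∀ y, KBounded.IsShape (E.symm y).1 (y : YoungDiagram) := fun y => by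
    have := hE (E.symm y)
    rwa [E.apply_symm_apply] at this
  have hσ : ∀ y, E.symm (E.permCongr (KBounded.rotatePerm k m) y) =
      KBounded.rotatePerm k m (E.symm y) := fun y => by
    rw [Equiv.permCongr_apply, E.symm_apply_apply]
  -- Both bijections pass through bounded windows, so each clause reduces to a statement about
  -- windows.
  refine ⟨E.symm.trans F, KBounded.rotation k m, E.permCongr (KBounded.rotatePerm k m),
    ?_, ?_, KBounded.rotation_dilatedVertex m, ?_, ?_, ?_, ?_⟩
  · intro y A
    rw [KBounded.corresponds_iff, Equiv.trans_apply, hF]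
    constructor
    · rintro ⟨g, hg, rfl, hs⟩
      rw [hs.window_unique hg (E.symm y).2.1 (hE' y)]
    · rintro rfl
      exact ⟨_, (E.symm y).2.1, rfl, hE' y⟩
  · intro lam a
    obtain ⟨g₀, rfl⟩ := F.surjective a
    rw [KBounded.corresponds_iff, Equiv.symm_trans_apply, F.symm_apply_apply, E.symm_symm, hF]
    constructor
    · rintro ⟨g, hg, hA, hs⟩
      rw [← KBounded.windowAlcove_injective g₀.2.1 hg hA] at hs
      exact hs.unique (hE g₀)
    · rintro rfl
      exact ⟨_, g₀.2.1, rfl, hE g₀⟩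
  · intro y
    rw [Equiv.trans_apply, Equiv.trans_apply, hF, hF, hσ, KBounded.rotatePerm_apply,
      KBounded.rotation_image_windowAlcove]
  · rw [← KBounded.orderOf_rotatePerm (k := k) hm]
    exact E.permCongrHom.orderOf_eq _
  · intro y z
    rw [KBounded.hasseAdj_iff (E.symm _).2.1 (E.symm _).2.1 (hE' _) (hE' _),
      KBounded.hasseAdj_iff (E.symm y).2.1 (E.symm z).2.1 (hE' y) (hE' z), hσ, hσ,
      KBounded.rotatePerm_apply, KBounded.rotatePerm_apply, KBounded.rotateWindow_affSwap_iff]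
  · rintro rfl y r
    have h := hE' (E.permCongr (KBounded.rotatePerm k 2) y)
    rw [hσ, KBounded.rotatePerm_apply] at h
    exact KBounded.suter_rowLen (E.symm y).2.1 (E.symm y).2.2 (hE' y) h r
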